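/- Let $p$ be a prime and let $G$ be a nonabelian group of order $p^m$ with $p^m > p^p$. Suppose that for each $k \in \{2, \dots, p+1\}$ the group $G$ has exactly one normal subgroup of index $p^k$. Then $G$ is of maximal class, that is, $G$ is nilpotent of class exactly $m-1$, and $m-1>1$. -/

import Mathlib

/-- A group is a `p`-group of maximal class if `p` is prime, its order is `p ^ m` for some `m`, and
it is nilpotent of class exactly `m - 1`, with `m - 1 > 1`. -/
def IsOfMaximalClass (p : ℕ) (G : Type*) [Group G] : Prop :=
  p.Prime ∧ ∃ m : ℕ, Nat.card G = p ^ m ∧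
    Group.IsNilpotent G ∧ Group.nilpotencyClass G + 1 = m ∧ 1 < Group.nilpotencyClass G

open scoped commutatorElement

/-! Write γ_i for `gam G i`. Every subgroup between γ_{i+1} and γ_i is normal, so uniqueness of a
normal subgroup of each index p², …, p^{p+1} forces |G : γ₂| = p², with G/γ₂ elementary abelian, and
then makes γ_i/γ_{i+1} cyclic for 2 ≤ i ≤ p (`gam_two_of_existsUnique`,
`exists_isLayerGen_of_existsUnique`). These layers have exponent p. If all later layers are also
cyclic, every step of the lower central series down to 1 has index p, apart from |G : γ₂| = p², and
the class is m - 1.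

Cyclicity propagates once generators a, b of G modulo γ₂ satisfy [γ_i, b] ≤ γ_{i+2} for every i ≥ 2:
then γ_{i+1}/γ_{i+2} is generated by [e, a], where e generates γ_i/γ_{i+1}. The proof extends this
condition one layer at a time.

For i ≤ p the argument is Lie-theoretic. The Jacobi identity settles odd i. At an even i < p, either
b still works, or the series stops at γ_{i+2}, which leaves nothing to prove beyond the first p
layers (`exists_two_step_centralizer`). For p = 2 squares are used instead.

For n > p the p-th power map takes over (`commutator_mem_gam_of_prime_lt`). The element a^p commutes
with a, so it lies deep in the series. On the other hand (xa)^p a^{-p} is the product of the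
conjugates of x by 1, a, …, a^{p-1}. Its Newton expansion has binomial exponents divisible by p
except in order p, where the coefficient is, modulo the next term, the (p-1)-fold commutator of x
with a. Taking x = [w, a] turns the left side into [w, a^p]; comparing the two sides shows that b
centralizes a generator of γ_n/γ_{n+1} modulo γ_{n+2}. -/

/-! ### Polynomial sequences in filtered groups -/

section PolynomialSequences

variable {G : Type*} [Group G]

/-- The difference operator on sequences in a group. -/
def seqDiff (g : ℕ → G) : ℕ → G := fun n => (g n)⁻¹ * g (n + 1)

/-- `PolyUpTo F d s g`: the `k`-th differences of `g` lie in `F (s + k)` for all `k ≤ d`. -/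
def PolyUpTo (F : ℕ → Subgroup G) : ℕ → ℕ → (ℕ → G) → Prop
  | 0, s, g => ∀ n, g n ∈ F s
  | d + 1, s, g => (∀ n, g n ∈ F s) ∧ PolyUpTo F d (s + 1) (seqDiff g)

variable {F : ℕ → Subgroup G}

lemma PolyUpTo.mem {d s : ℕ} {g : ℕ → G} (h : PolyUpTo F d s g) (n : ℕ) : g n ∈ F s := by
  cases d with
  | zero => exact h n
  | succ d => exact h.1 n

lemma PolyUpTo.pred {d s : ℕ} {g : ℕ → G} (h : PolyUpTo F (d + 1) s g) : PolyUpTo F d s g := by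
  induction d generalizing s g with
  | zero => exact h.1
  | succ d ih => exact ⟨h.1, ih h.2⟩

lemma PolyUpTo.mono (hF : Antitone F) {d s t : ℕ} (hst : t ≤ s) {g : ℕ → G}
    (h : PolyUpTo F d s g) : PolyUpTo F d t g := by
  induction d generalizing s t g with
  | zero => exact fun n => hF hst (h n)
  | succ d ih => exact ⟨fun n => hF hst (h.1 n), ih (Nat.succ_le_succ hst) h.2⟩

/-- This is the Lazard–Leibman closure argument. The three claims must be proved together, because
the difference of a product contains conjugates, hence commutators, and the difference of a
commutator contains products. -/
lemma polyUpTo_closure (hF : Antitone F) (hc : ∀ s t, ⁅F s, F t⁆ ≤ F (s + t + 1)) (d : ℕ) :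
    (∀ s g h, PolyUpTo F d s g → PolyUpTo F d s h → PolyUpTo F d s (g * h)) ∧
    (∀ s g, PolyUpTo F d s g → PolyUpTo F d s g⁻¹) ∧
    (∀ s t g h, PolyUpTo F d s g → PolyUpTo F d t h → PolyUpTo F d (s + t + 1) ⁅g, h⁆) := by
  induction d with
  | zero =>
    exact ⟨fun s g h hg hh n => mul_mem (hg n) (hh n), fun s g hg n => inv_mem (hg n),
      fun s t g h hg hh n => hc s t (Subgroup.commutator_mem_commutator (hg n) (hh n))⟩
  | succ d ih =>
    obtain ⟨imul, iinv, icomm⟩ := ih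
    have conj : ∀ s t g h, PolyUpTo F d s g → PolyUpTo F d t h →
        PolyUpTo F d t (g * h * g⁻¹) := by
      intro s t g h hg hh
      have : g * h * g⁻¹ = ⁅g, h⁆ * h := by rw [commutatorElement_def]; group
      rw [this]
      exact imul _ _ _ ((icomm s t g h hg hh).mono hF (by omega)) hh
    refine ⟨fun s g h hg hh => ⟨fun n => mul_mem (hg.1 n) (hh.1 n), ?_⟩,
      fun s g hg => ⟨fun n => inv_mem (hg.1 n), ?_⟩, fun s t g h hg hh =>
      ⟨fun n => hc s t (Subgroup.commutator_mem_commutator (hg.1 n) (hh.1 n)), ?_⟩⟩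
    · have : seqDiff (g * h) = h⁻¹ * seqDiff g * (h⁻¹)⁻¹ * seqDiff h := by
        funext n; simp [seqDiff]; group
      rw [this]
      exact imul _ _ _ (conj s _ _ _ (iinv _ _ hh.pred) hg.2) hh.2
    · have : seqDiff g⁻¹ = g * (seqDiff g)⁻¹ * g⁻¹ := by
        funext n; simp [seqDiff]; group
      rw [this]
      exact conj s _ _ _ hg.pred (iinv _ _ hg.2)
    · have : seqDiff ⁅g, h⁆ = (⁅g, h⁆⁻¹ * (g * ⁅seqDiff g, h * seqDiff h⁆ * g⁻¹) * (⁅g, h⁆⁻¹)⁻¹) *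
          (h * ⁅g, seqDiff h⁆ * h⁻¹) := by
        funext n; simp [seqDiff, commutatorElement_def]; group
      rw [this]
      have hc0 := icomm s t g h hg.pred hh.pred
      have h1 : PolyUpTo F d t (h * seqDiff h) :=
        imul _ _ _ hh.pred (hh.2.mono hF (by omega))
      have h2 := (icomm _ _ _ _ hg.2 h1).mono (t := s + t + 1 + 1) hF (by omega)
      have h3 := (icomm _ _ _ _ hg.pred hh.2).mono (t := s + t + 1 + 1) hF (by omega)
      exact imul _ _ _ (conj _ _ _ _ (iinv _ _ hc0) (conj _ _ _ _ hg.pred h2))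
        (conj _ _ _ _ hh.pred h3)

/-- `g` is polynomial of level `s`: all its `k`-th differences lie in `F (s + k)`. -/
def IsPolySeq (F : ℕ → Subgroup G) (s : ℕ) (g : ℕ → G) : Prop := ∀ d, PolyUpTo F d s g

lemma IsPolySeq.mem {s : ℕ} {g : ℕ → G} (h : IsPolySeq F s g) (n : ℕ) : g n ∈ F s := h 0 n

lemma IsPolySeq.diff {s : ℕ} {g : ℕ → G} (h : IsPolySeq F s g) : IsPolySeq F (s + 1) (seqDiff g) :=
  fun d => (h (d + 1)).2

lemma IsPolySeq.mono (hF : Antitone F) {s t : ℕ} (hst : t ≤ s) {g : ℕ → G} (h : IsPolySeq F s g) :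
    IsPolySeq F t g := fun d => (h d).mono hF hst

lemma isPolySeq_of_seqDiff {s : ℕ} {g : ℕ → G} (h0 : ∀ n, g n ∈ F s)
    (h : IsPolySeq F (s + 1) (seqDiff g)) : IsPolySeq F s g := by
  intro d
  cases d with
  | zero => exact h0
  | succ d => exact ⟨h0, h d⟩

lemma isPolySeq_one (s : ℕ) : IsPolySeq F s 1 := by
  intro d
  induction d generalizing s with
  | zero => exact fun n => one_mem _
  | succ d ih =>
    refine ⟨fun n => one_mem _, ?_⟩
    have : seqDiff (1 : ℕ → G) = 1 := by funext n; simp [seqDiff]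
    rw [this]; exact ih _

lemma IsPolySeq.mul (hF : Antitone F) (hc : ∀ s t, ⁅F s, F t⁆ ≤ F (s + t + 1)) {s : ℕ} {g h : ℕ → G}
    (hg : IsPolySeq F s g) (hh : IsPolySeq F s h) : IsPolySeq F s (g * h) :=
  fun d => (polyUpTo_closure hF hc d).1 _ _ _ (hg d) (hh d)

lemma IsPolySeq.inv (hF : Antitone F) (hc : ∀ s t, ⁅F s, F t⁆ ≤ F (s + t + 1)) {s : ℕ} {g : ℕ → G}
    (hg : IsPolySeq F s g) : IsPolySeq F s g⁻¹ :=
  fun d => (polyUpTo_closure hF hc d).2.1 _ _ (hg d)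

lemma IsPolySeq.commutator (hF : Antitone F) (hc : ∀ s t, ⁅F s, F t⁆ ≤ F (s + t + 1)) {s t : ℕ}
    {g h : ℕ → G} (hg : IsPolySeq F s g) (hh : IsPolySeq F t h) : IsPolySeq F (s + t + 1) ⁅g, h⁆ :=
  fun d => (polyUpTo_closure hF hc d).2.2 _ _ _ _ (hg d) (hh d)

lemma IsPolySeq.iterate_mem {s : ℕ} {g : ℕ → G} (h : IsPolySeq F s g) (k n : ℕ) :
    (seqDiff^[k] g) n ∈ F (s + k) := by
  induction k generalizing s g with
  | zero => exact h.mem n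
  | succ k ih =>
    rw [Function.iterate_succ_apply, show s + (k + 1) = s + 1 + k by omega]
    exact ih h.diff

/-- Iterated differences are multiplicative modulo the next term of the filtration. -/
lemma IsPolySeq.iterate_seqDiff_mul (hF : Antitone F) (hn : ∀ s, (F s).Normal)
    (hc : ∀ s t, ⁅F s, F t⁆ ≤ F (s + t + 1)) (k : ℕ) {s : ℕ} {g h : ℕ → G}
    (hg : IsPolySeq F s g) (hh : IsPolySeq F s h) (n : ℕ) :
    (QuotientGroup.mk (seqDiff^[k] (g * h) n) : G ⧸ F (s + k + 1)) =
      QuotientGroup.mk (seqDiff^[k] g n) * QuotientGroup.mk (seqDiff^[k] h n) := by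
  induction k generalizing s g h with
  | zero => rfl
  | succ k ih =>
    -- The commutator factor has level 2s + 2. Because of the extra 1 in the filtration hypothesis
    -- this is at least s + 2 even when s = 0, so the factor vanishes in the quotient.
    have e : seqDiff (g * h) = ⁅h⁻¹, seqDiff g⁆ * (seqDiff g * seqDiff h) := by
      funext n; simp [seqDiff, commutatorElement_def]; group
    have h1 := (hh.inv hF hc).commutator hF hc hg.diff
    simp only [Function.iterate_succ_apply, e]
    have key := ih (h1.mono (t := s + 1) hF (by omega)) (hg.diff.mul hF hc hh.diff)
    have key2 := ih hg.diff hh.diff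
    have hz : (QuotientGroup.mk (seqDiff^[k] ⁅h⁻¹, seqDiff g⁆ n) : G ⧸ F (s + 1 + k + 1)) = 1 :=
      (QuotientGroup.eq_one_iff _).2 (hF (by omega) (h1.iterate_mem k n))
    rw [key2, hz, one_mul] at key
    rw [show s + (k + 1) + 1 = s + 1 + k + 1 by omega]
    exact key

/-- The sequence `n ↦ g ^ (n.choose k)`. -/
def binomSeq (g : G) (k : ℕ) : ℕ → G := fun n => g ^ n.choose k

lemma seqDiff_binomSeq_succ (g : G) (k : ℕ) : seqDiff (binomSeq g (k + 1)) = binomSeq g k := by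
  funext n
  simp only [seqDiff, binomSeq, Nat.choose_succ_succ', pow_add]
  rw [(Commute.pow_pow_self g _ _).eq]; simp

lemma seqDiff_binomSeq_zero (g : G) : seqDiff (binomSeq g 0) = 1 := by
  funext n; simp [seqDiff, binomSeq]

lemma isPolySeq_binomSeq (hF : Antitone F) (k : ℕ) {s : ℕ} {g : G} (hg : g ∈ F (s + k)) :
    IsPolySeq F s (binomSeq g k) := by
  induction k generalizing s with
  | zero =>
    refine isPolySeq_of_seqDiff (fun n => pow_mem hg _) ?_
    rw [seqDiff_binomSeq_zero]; exact isPolySeq_one _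
  | succ k ih =>
    refine isPolySeq_of_seqDiff (fun n => pow_mem (hF (by omega) hg) _) ?_
    rw [seqDiff_binomSeq_succ]
    exact ih (by rwa [show s + 1 + k = s + (k + 1) by omega])

lemma iterate_seqDiff_one (k : ℕ) : seqDiff^[k] (1 : ℕ → G) = 1 := by
  induction k with
  | zero => rfl
  | succ k ih =>
    rw [Function.iterate_succ_apply, show seqDiff (1 : ℕ → G) = 1 by funext n; simp [seqDiff], ih]

lemma iterate_seqDiff_binomSeq {k m : ℕ} (h : k < m) (g : G) :
    seqDiff^[m] (binomSeq g k) = 1 := by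
  induction k generalizing m with
  | zero =>
    obtain ⟨m, rfl⟩ := Nat.exists_eq_succ_of_ne_zero (show m ≠ 0 by omega)
    rw [Function.iterate_succ_apply, seqDiff_binomSeq_zero, iterate_seqDiff_one]
  | succ k ih =>
    obtain ⟨m, rfl⟩ := Nat.exists_eq_succ_of_ne_zero (show m ≠ 0 by omega)
    rw [Function.iterate_succ_apply, seqDiff_binomSeq_succ, ih (by omega)]

lemma iterate_seqDiff_zero_of_eq_one (k : ℕ) {R : ℕ → G} (h : ∀ i < k, R i = 1) :
    seqDiff^[k] R 0 = R k := by
  induction k generalizing R with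
  | zero => rfl
  | succ k ih =>
    rw [Function.iterate_succ_apply, ih]
    · simp [seqDiff, h k (by omega)]
    · intro i hi; simp [seqDiff, h i (by omega), h (i + 1) (by omega)]

/-- Newton expansion of a polynomial sequence at a prime argument: modulo a subgroup `K` which
contains the `p`-th powers of the coefficients, only the coefficient of order `p` survives. -/
lemma IsPolySeq.newton_prime (hF : Antitone F) (hn : ∀ s, (F s).Normal)
    (hc : ∀ s t, ⁅F s, F t⁆ ≤ F (s + t + 1)) {p : ℕ} (hp : p.Prime) {K : Subgroup G} {k : ℕ}
    (hk : 1 ≤ k) (hkp : k ≤ p) (hK : ∀ z ∈ F k, z ^ p ∈ K) {P : ℕ → G} (hP : IsPolySeq F 0 P)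
    (hP0 : ∀ i < k, P i = 1) :
    ∃ r ∈ F p, (P p ∈ K ↔ r ∈ K) ∧
      (QuotientGroup.mk r : G ⧸ F (p + 1)) = QuotientGroup.mk (seqDiff^[p] P 0) := by
  induction hd : p - k generalizing k P with
  | zero =>
    obtain rfl : k = p := by omega
    have e := iterate_seqDiff_zero_of_eq_one k hP0
    refine ⟨P k, ?_, Iff.rfl, by rw [e]⟩
    rw [← e]; simpa using hP.iterate_mem k 0
  | succ d ih =>
    have hlt : k < p := by omega
    have hg : P k ∈ F (0 + k) := by
      rw [← iterate_seqDiff_zero_of_eq_one k hP0]; exact hP.iterate_mem k 0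
    -- Dividing by the leading term P(k)^(n choose k) makes the sequence vanish at k as well. At n =
    -- p that term is a p-th power of an element of F k, up to a further power, so membership in `K`
    -- is unaffected.
    have hB := isPolySeq_binomSeq hF k hg
    have hR : IsPolySeq F 0 ((binomSeq (P k) k)⁻¹ * P) := (hB.inv hF hc).mul hF hc hP
    obtain ⟨r, hr, hr1, hr2⟩ := ih (k := k + 1) (P := (binomSeq (P k) k)⁻¹ * P) (by omega)
      (by omega) (fun z hz => hK z (hF (by omega) hz)) hR (by
        intro i hi
        rcases Nat.lt_succ_iff_lt_or_eq.1 hi with h | rfl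
        · simp [binomSeq, hP0 i h, Nat.choose_eq_zero_of_lt h]
        · simp [binomSeq]) (by omega)
    refine ⟨r, hr, ?_, ?_⟩
    · rw [← hr1]
      have : binomSeq (P k) k p ∈ K := by
        obtain ⟨c, hc⟩ := hp.dvd_choose_self (by omega : k ≠ 0) hlt
        simp only [binomSeq, hc, pow_mul]
        exact pow_mem (hK _ (by simpa using hg)) _
      exact (Subgroup.mul_mem_cancel_left K (inv_mem this)).symm
    -- The p-th difference kills a binomial term of order k < p, so modulo F (p + 1) the division
    -- does not change it.
    · have h1 := hB.iterate_seqDiff_mul hF hn hc p hR 0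
      have e : binomSeq (P k) k * ((binomSeq (P k) k)⁻¹ * P) = P := by group
      rw [e, iterate_seqDiff_binomSeq hlt] at h1
      simp only [Pi.one_apply, QuotientGroup.mk_one, one_mul] at h1
      rw [QuotientGroup.eq, Nat.zero_add, ← QuotientGroup.eq] at h1
      rw [hr2, h1]

end PolynomialSequences

/-! ### The power (xa)^n a^{-n} as a polynomial sequence -/

section PowerSequence

variable {G : Type*} [Group G]

/-- The sequence `n ↦ (x * a) ^ n * a ^ (-n)`, that is `x · ᵃx · ᵃᵃx ⋯`. -/
def normSeq (x a : G) : ℕ → G := fun n => (x * a) ^ n * (a ^ n)⁻¹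

/-- The operator `x ↦ ⁅x⁻¹, a⁆ = x⁻¹ · ᵃx`. -/
def conjDiff (a x : G) : G := ⁅x⁻¹, a⁆

/-- The sequence of conjugates of `x` by the powers of `a`. -/
def conjSeq (a x : G) : ℕ → G := fun n => a ^ n * x * (a ^ n)⁻¹

lemma seqDiff_normSeq (x a : G) : seqDiff (normSeq x a) = conjSeq a x := by
  funext n; simp [seqDiff, normSeq, conjSeq, pow_succ]; group

lemma seqDiff_conjSeq (x a : G) : seqDiff (conjSeq a x) = conjSeq a (conjDiff a x) := by
  funext n; simp [seqDiff, conjDiff, conjSeq, pow_succ, commutatorElement_def]; group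

lemma iterate_seqDiff_normSeq (x a : G) (k : ℕ) :
    seqDiff^[k + 1] (normSeq x a) 0 = (conjDiff a)^[k] x := by
  have h : ∀ k (x : G), seqDiff^[k] (conjSeq a x) = conjSeq a ((conjDiff a)^[k] x) := by
    intro k
    induction k with
    | zero => intro x; rfl
    | succ k ih =>
      intro x
      rw [Function.iterate_succ_apply, seqDiff_conjSeq, ih, Function.iterate_succ_apply]
  rw [Function.iterate_succ_apply, seqDiff_normSeq, h]; simp [conjSeq]

lemma isPolySeq_normSeq {F : ℕ → Subgroup G} (hF : Antitone F) (hn : ∀ s, (F s).Normal) {x a : G}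
    (hx : ∀ k, (conjDiff a)^[k] x ∈ F (k + 1)) : IsPolySeq F 0 (normSeq x a) := by
  have hconj : ∀ {s} {y : G} (n : ℕ), y ∈ F s → conjSeq a y n ∈ F s :=
    fun {s y} n hy => (hn s).conj_mem y hy _
  refine isPolySeq_of_seqDiff ?_ ?_
  · intro n
    induction n with
    | zero => simp [normSeq]
    | succ n ih =>
      have : normSeq x a (n + 1) = normSeq x a n * seqDiff (normSeq x a) n := by simp [seqDiff]
      rw [this, seqDiff_normSeq]
      exact mul_mem ih (hF (by omega) (hconj n (hx 0)))
  · rw [seqDiff_normSeq]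
    have : ∀ d s (y : G), (∀ k, (conjDiff a)^[k] y ∈ F (k + s)) →
        PolyUpTo F d s (conjSeq a y) := by
      intro d
      induction d with
      | zero => intro s y hy n; exact hconj n (by simpa using hy 0)
      | succ d ih =>
        intro s y hy
        refine ⟨fun n => hconj n (by simpa using hy 0), ?_⟩
        rw [seqDiff_conjSeq]
        refine ih _ _ fun k => ?_
        rw [← Function.iterate_succ_apply, show k + (s + 1) = k + 1 + s by omega]
        exact hy _
    exact fun d => this d _ x hx

end PowerSequence

/-! ### The lower central series, indexed from one -/

section LowerCentral

variable (G : Type*) [Group G]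

/-- The lower central series indexed so that `gam G 1 = ⊤` (and `gam G 0 = ⊤`). -/
def gam (i : ℕ) : Subgroup G := (⊤ : Subgroup G).lowerCentralSeries (i - 1)

/-- The projection to the quotient by a term of the lower central series. -/
abbrev gamMk (N : ℕ) [(gam G N).Normal] : G →* G ⧸ gam G N := QuotientGroup.mk' _

variable {G}

lemma gam_one : gam G 1 = ⊤ := rfl

lemma gam_succ {i : ℕ} (hi : 1 ≤ i) : gam G (i + 1) = ⁅gam G i, ⊤⁆ := by
  obtain ⟨i, rfl⟩ := Nat.exists_eq_add_of_le' hi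
  rfl

instance gam_normal (i : ℕ) : (gam G i).Normal := by
  unfold gam; infer_instance

lemma gam_antitone : Antitone (gam G) := fun _ _ h =>
  Subgroup.lowerCentralSeries_antitone _ (Nat.sub_le_sub_right h 1)

lemma gamMk_eq_one {N : ℕ} {x : G} : gamMk G N x = 1 ↔ x ∈ gam G N :=
  QuotientGroup.eq_one_iff x

lemma gamMk_of_mem {N : ℕ} {x : G} (hx : x ∈ gam G N) : gamMk G N x = 1 := gamMk_eq_one.2 hx

lemma le_iff_map_mk'_eq_bot (N : Subgroup G) [N.Normal] (H : Subgroup G) :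
    H ≤ N ↔ H.map (QuotientGroup.mk' N) = ⊥ := by
  rw [Subgroup.map_eq_bot_iff, QuotientGroup.ker_mk']

lemma commutator_gam_le (i j : ℕ) : ⁅gam G i, gam G j⁆ ≤ gam G (i + j) := by
  induction j generalizing i with
  | zero => exact Subgroup.commutator_le_left _ _
  | succ j ih =>
    rcases Nat.eq_zero_or_pos i with rfl | hi
    · rw [Nat.zero_add]; exact Subgroup.commutator_le_right _ _
    rcases Nat.eq_zero_or_pos j with rfl | hj
    · rw [gam_one, gam_succ hi]
    have h1 : ⁅⁅(⊤ : Subgroup G), gam G i⁆, gam G j⁆ ≤ gam G (i + (j + 1)) := by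
      rw [Subgroup.commutator_comm ⊤, ← gam_succ hi]
      exact (ih (i + 1)).trans (gam_antitone (by omega))
    have h2 : ⁅⁅gam G i, gam G j⁆, (⊤ : Subgroup G)⁆ ≤ gam G (i + (j + 1)) := by
      rw [← add_assoc, gam_succ (by omega)]
      exact Subgroup.commutator_mono (ih i) le_rfl
    rw [gam_succ hj, Subgroup.commutator_comm]
    rw [le_iff_map_mk'_eq_bot, Subgroup.map_commutator, Subgroup.map_commutator] at *
    exact Subgroup.commutator_commutator_eq_bot_of_rotate h1 h2

lemma commutator_mem_gam {i j : ℕ} {x y : G} (hx : x ∈ gam G i) (hy : y ∈ gam G j) :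
    ⁅x, y⁆ ∈ gam G (i + j) :=
  commutator_gam_le i j (Subgroup.commutator_mem_commutator hx hy)

lemma mem_gam_one (x : G) : x ∈ gam G 1 := Subgroup.mem_top x

lemma mem_gam_of_le {i j : ℕ} (h : j ≤ i) {x : G} (hx : x ∈ gam G i) : x ∈ gam G j :=
  gam_antitone h hx

lemma gamMk_commute {k : ℕ} {x : G} (hx : x ∈ gam G k) (g : G) :
    Commute (gamMk G (k + 1) x) (gamMk G (k + 1) g) := by
  rw [← commutatorElement_eq_one_iff_commute, ← map_commutatorElement, gamMk_eq_one]
  exact commutator_mem_gam hx (mem_gam_one g)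

lemma gamMk_commutator_mul_left {r s : ℕ} (x : G) {y z : G} (hy : y ∈ gam G r)
    (hz : z ∈ gam G s) : gamMk G (r + s + 1) ⁅x * y, z⁆ =
      gamMk G (r + s + 1) ⁅x, z⁆ * gamMk G (r + s + 1) ⁅y, z⁆ := by
  have h := commutator_mem_gam hy hz
  rw [commutatorElement_mul_left_eq_conj_mul, map_mul, map_mul, map_mul,
    ← (gamMk_commute h x).eq, mul_assoc (gamMk G (r + s + 1) ⁅y, z⁆), ← map_mul _ x,
    mul_inv_cancel, map_one, mul_one, (gamMk_commute h _).eq]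

/-- Commutation with an element of `gam G s` as a homomorphism on `gam G r`. -/
def commutatorHom (r : ℕ) {s : ℕ} {z : G} (hz : z ∈ gam G s) :
    gam G r →* G ⧸ gam G (r + s + 1) where
  toFun x := gamMk G (r + s + 1) ⁅(x : G), z⁆
  map_one' := by simp
  map_mul' x y := gamMk_commutator_mul_left _ y.2 hz

lemma gamMk_commutator_zpow_left {r s : ℕ} {x z : G} (hx : x ∈ gam G r) (hz : z ∈ gam G s)
    (k : ℤ) : gamMk G (r + s + 1) ⁅x ^ k, z⁆ = gamMk G (r + s + 1) ⁅x, z⁆ ^ k :=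
  map_zpow (commutatorHom r hz) ⟨x, hx⟩ k

lemma gamMk_commutator_pow_left {r s : ℕ} {x z : G} (hx : x ∈ gam G r) (hz : z ∈ gam G s)
    (k : ℕ) : gamMk G (r + s + 1) ⁅x ^ k, z⁆ = gamMk G (r + s + 1) ⁅x, z⁆ ^ k :=
  map_pow (commutatorHom r hz) ⟨x, hx⟩ k

lemma gamMk_commutator_mul_right {r s : ℕ} {x : G} (y : G) {z : G} (hx : x ∈ gam G r)
    (hz : z ∈ gam G s) : gamMk G (r + s + 1) ⁅x, y * z⁆ =
      gamMk G (r + s + 1) ⁅x, y⁆ * gamMk G (r + s + 1) ⁅x, z⁆ := by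
  have h := gamMk_commutator_mul_left y hz hx
  rw [Nat.add_comm s r] at h
  rw [← commutatorElement_inv (y * z), map_inv, h, mul_inv_rev, ← map_inv, ← map_inv,
    commutatorElement_inv, commutatorElement_inv, (gamMk_commute (commutator_mem_gam hx hz) _).eq]

lemma gamMk_commutator_zpow_right {r s : ℕ} {x z : G} (hx : x ∈ gam G r) (hz : z ∈ gam G s)
    (k : ℤ) : gamMk G (r + s + 1) ⁅x, z ^ k⁆ = gamMk G (r + s + 1) ⁅x, z⁆ ^ k := by
  have h := gamMk_commutator_zpow_left hz hx k
  rw [Nat.add_comm s r] at h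
  rw [← commutatorElement_inv, map_inv, h, ← inv_zpow, ← map_inv, commutatorElement_inv]

lemma gamMk_commutator_left_congr {r s : ℕ} {x y z : G} (hz : z ∈ gam G s)
    (h : gamMk G (r + 1) x = gamMk G (r + 1) y) :
    gamMk G (r + s + 1) ⁅x, z⁆ = gamMk G (r + s + 1) ⁅y, z⁆ := by
  have h1 : x⁻¹ * y ∈ gam G (r + 1) := QuotientGroup.eq.1 h
  have h2 := gamMk_commutator_mul_left x (mem_gam_of_le (Nat.le_succ r) h1) hz
  rw [mul_inv_cancel_left] at h2
  rw [h2, gamMk_eq_one.2 (mem_gam_of_le (by omega) (commutator_mem_gam h1 hz)), mul_one]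

/-- The Jacobi identity modulo the lower central series. -/
lemma gamMk_jacobi {r s t : ℕ} {x y z : G} (hr : 1 ≤ r) (hs : 1 ≤ s) (ht : 1 ≤ t)
    (hx : x ∈ gam G r) (hy : y ∈ gam G s) (hz : z ∈ gam G t) :
    gamMk G (r + s + t + 1) ⁅⁅x, y⁆, z⁆ * gamMk G (r + s + t + 1) ⁅⁅y, z⁆, x⁆ *
      gamMk G (r + s + t + 1) ⁅⁅z, x⁆, y⁆ = 1 := by
  have key : ∀ {i j k : ℕ} {u v w : G}, 1 ≤ i → 1 ≤ j → 1 ≤ k → i + j + k = r + s + t →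
      u ∈ gam G i → v ∈ gam G j → w ∈ gam G k →
      gamMk G (r + s + t + 1) ⁅⁅u, v⁆, v * w * v⁻¹⁆ = gamMk G (r + s + t + 1) ⁅⁅u, v⁆, w⁆ := by
    intro i j k u v w hi hj hk hijk hu hv hw
    have huv := commutator_mem_gam hu hv
    have e : v * w * v⁻¹ = ⁅v, w⁆ * w := by rw [commutatorElement_def]; group
    have h := gamMk_commutator_mul_right ⁅v, w⁆ huv hw
    rw [hijk] at h
    rw [e, h, gamMk_eq_one.2, one_mul]
    exact mem_gam_of_le (by omega) (commutator_mem_gam huv (commutator_mem_gam hv hw))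
  have h := congrArg (gamMk G (r + s + t + 1)) (commutatorElement_commutatorElement_conj_mul x y z)
  rw [map_mul, map_mul, map_one, key hr hs ht rfl hx hy hz, key hs ht hr (by omega) hy hz hx,
    key ht hr hs (by omega) hz hx hy] at h
  exact h

/-- The elements which commute with `g` modulo a normal subgroup. -/
def centralizerMod (N : Subgroup G) [N.Normal] (g : G) : Subgroup G :=
  (Subgroup.centralizer {QuotientGroup.mk' N g}).comap (QuotientGroup.mk' N)

lemma mem_centralizerMod {N : Subgroup G} [N.Normal] {g x : G} :
    x ∈ centralizerMod N g ↔ ⁅x, g⁆ ∈ N := by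
  rw [centralizerMod, Subgroup.mem_comap, Subgroup.mem_centralizer_singleton_iff,
    ← QuotientGroup.eq_one_iff, ← QuotientGroup.mk'_apply, map_commutatorElement,
    commutatorElement_eq_one_iff_mul_comm]

lemma mem_centralizerMod_comm {N : Subgroup G} [N.Normal] {g x : G} :
    x ∈ centralizerMod N g ↔ g ∈ centralizerMod N x := by
  rw [mem_centralizerMod, mem_centralizerMod, ← commutatorElement_inv, inv_mem_iff]

/-- `e` generates the layer `gam G i / gam G (i + 1)`. -/
def IsLayerGen (i : ℕ) (e : G) : Prop :=
  e ∈ gam G i ∧ gam G i ≤ Subgroup.zpowers e ⊔ gam G (i + 1)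

lemma mem_zpowers_sup {i : ℕ} {e x : G} (hx : x ∈ Subgroup.zpowers e ⊔ gam G i) :
    ∃ k : ℤ, ∃ z ∈ gam G i, e ^ k * z = x := by
  obtain ⟨y, ⟨k, rfl⟩, z, hz, rfl⟩ := Subgroup.mem_sup_of_normal_right.1 hx
  exact ⟨k, z, hz, rfl⟩

lemma IsLayerGen.inv {i : ℕ} {e : G} (h : IsLayerGen i e) : IsLayerGen i e⁻¹ :=
  ⟨inv_mem h.1, by rw [Subgroup.zpowers_inv]; exact h.2⟩

lemma IsLayerGen.commutator_mem {i : ℕ} {e g : G} (h : IsLayerGen i e)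
    (hg : ⁅e, g⁆ ∈ gam G (i + 2)) {x : G} (hx : x ∈ gam G i) : ⁅x, g⁆ ∈ gam G (i + 2) := by
  rw [← mem_centralizerMod] at hg ⊢
  refine (h.2.trans (sup_le (by simpa using hg) fun y hy => ?_)) hx
  exact mem_centralizerMod.2 (mem_gam_of_le (by omega) (commutator_mem_gam hy (mem_gam_one g)))

lemma IsLayerGen.le_of_mem {i : ℕ} {e a b : G} (hi : 1 ≤ i) (h : IsLayerGen i e)
    (hab : ⊤ ≤ Subgroup.closure {a, b} ⊔ gam G 2) {Q : Subgroup G} [Q.Normal]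
    (hQ : gam G (i + 2) ≤ Q) (ha : ⁅e, a⁆ ∈ Q) (hb : ⁅e, b⁆ ∈ Q) : gam G (i + 1) ≤ Q := by
  have h1 : ∀ g, ⁅e, g⁆ ∈ Q := by
    intro g
    rw [← mem_centralizerMod, mem_centralizerMod_comm]
    refine (hab.trans (sup_le ((Subgroup.closure_le _).2 ?_) ?_)) (Subgroup.mem_top g)
    · rintro x (rfl | rfl)
      · exact mem_centralizerMod_comm.1 (mem_centralizerMod.2 ha)
      · exact mem_centralizerMod_comm.1 (mem_centralizerMod.2 hb)
    · intro x hx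
      exact mem_centralizerMod_comm.1 (mem_centralizerMod.2 (hQ (commutator_mem_gam h.1 hx)))
  rw [gam_succ hi, Subgroup.commutator_le]
  intro x hx g _
  rw [← mem_centralizerMod]
  refine (h.2.trans (sup_le (by simpa using mem_centralizerMod.2 (h1 g)) fun y hy => ?_)) hx
  exact mem_centralizerMod.2 (hQ (mem_gam_of_le (by omega)
    (commutator_mem_gam hy (mem_gam_one g))))

/-- A layer of the lower central series is central in the quotient, so its subgroups are all normal.
This is what allows normal subgroups to be counted inside a layer. -/
lemma normal_of_gam_le {i : ℕ} (hi : 1 ≤ i) {H : Subgroup G} (h1 : gam G (i + 1) ≤ H)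
    (h2 : H ≤ gam G i) : H.Normal := by
  rw [← Subgroup.commutator_top_right_le_iff]
  exact ((Subgroup.commutator_mono h2 le_rfl).trans (gam_succ hi).ge).trans h1

lemma zpowers_sup_gam_normal {i : ℕ} (hi : 1 ≤ i) {c : G} (hc : c ∈ gam G i) :
    (Subgroup.zpowers c ⊔ gam G (i + 1)).Normal :=
  normal_of_gam_le hi le_sup_right (sup_le (by simpa using hc) (gam_antitone (Nat.le_succ i)))

lemma IsLayerGen.succ {i : ℕ} {e a b : G} (hi : 1 ≤ i) (h : IsLayerGen i e)
    (hab : ⊤ ≤ Subgroup.closure {a, b} ⊔ gam G 2) (hb : ⁅e, b⁆ ∈ gam G (i + 2)) :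
    IsLayerGen (i + 1) ⁅e, a⁆ := by
  have hm : ⁅e, a⁆ ∈ gam G (i + 1) := commutator_mem_gam h.1 (mem_gam_one a)
  have := zpowers_sup_gam_normal (by omega) hm
  exact ⟨hm, h.le_of_mem hi hab le_sup_right
    (Subgroup.mem_sup_left (Subgroup.mem_zpowers _)) (Subgroup.mem_sup_right hb)⟩

/-- Modulo γ₃ and [b, a], the generators a and b commute and γ₂ is central, so the quotient is
abelian. -/
lemma isLayerGen_two {a b : G} (hab : ⊤ ≤ Subgroup.closure {a, b} ⊔ gam G 2) :
    IsLayerGen 2 ⁅b, a⁆ := by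
  have hm : ⁅b, a⁆ ∈ gam G 2 := commutator_mem_gam (mem_gam_one b) (mem_gam_one a)
  have hN := zpowers_sup_gam_normal (by omega) hm
  have hQ : gam G 3 ≤ Subgroup.zpowers ⁅b, a⁆ ⊔ gam G (2 + 1) := le_sup_right
  have hba : ⁅b, a⁆ ∈ Subgroup.zpowers ⁅b, a⁆ ⊔ gam G (2 + 1) :=
    Subgroup.mem_sup_left (Subgroup.mem_zpowers _)
  have key : ∀ g, a ∈ centralizerMod (Subgroup.zpowers ⁅b, a⁆ ⊔ gam G (2 + 1)) g →
      b ∈ centralizerMod (Subgroup.zpowers ⁅b, a⁆ ⊔ gam G (2 + 1)) g → ∀ x,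
      x ∈ centralizerMod (Subgroup.zpowers ⁅b, a⁆ ⊔ gam G (2 + 1)) g := by
    intro g h1 h2 x
    refine (hab.trans (sup_le ((Subgroup.closure_le _).2 ?_) ?_)) (Subgroup.mem_top x)
    · rintro x (rfl | rfl) <;> assumption
    · intro y hy
      exact mem_centralizerMod.2 (hQ (commutator_mem_gam hy (mem_gam_one g)))
  have ha := key a (mem_centralizerMod.2 (by simp)) (mem_centralizerMod.2 hba)
  have hb := key b (mem_centralizerMod_comm.1 (mem_centralizerMod.2 hba))
    (mem_centralizerMod.2 (by simp))
  refine ⟨hm, ?_⟩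
  rw [show gam G 2 = ⁅gam G 1, ⊤⁆ from gam_succ le_rfl, Subgroup.commutator_le]
  intro x _ g _
  exact mem_centralizerMod.1 (key g (mem_centralizerMod_comm.1 (ha g))
    (mem_centralizerMod_comm.1 (hb g)) x)

lemma pow_prime_mem_gam {p : ℕ} (h2 : ∀ x : G, x ^ p ∈ gam G 2) {i : ℕ} (hi : 1 ≤ i) {x : G}
    (hx : x ∈ gam G i) : x ^ p ∈ gam G (i + 1) := by
  induction i, hi using Nat.le_induction generalizing x with
  | base => exact h2 x
  | succ i hi ih =>
    have key : x ∈ gam G (i + 1) ∧ x ^ p ∈ gam G (i + 1 + 1) := by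
      rw [gam_succ hi, Subgroup.commutator_def] at hx
      induction hx using Subgroup.closure_induction with
      | mem y hy =>
        obtain ⟨u, hu, g, -, rfl⟩ := hy
        refine ⟨commutator_mem_gam hu (mem_gam_one g), ?_⟩
        have h := gamMk_commutator_pow_left hu (mem_gam_one g) p
        rw [← map_pow, gamMk_eq_one.2 (commutator_mem_gam (ih hu) (mem_gam_one g))] at h
        exact gamMk_eq_one.1 h.symm
      | one => exact ⟨one_mem _, by simp⟩
      | mul y z _ _ hy hz =>
        refine ⟨mul_mem hy.1 hz.1, ?_⟩
        rw [← gamMk_eq_one, map_pow, map_mul, (gamMk_commute hy.1 z).mul_pow, ← map_pow, ← map_pow,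
          gamMk_eq_one.2 hy.2, gamMk_eq_one.2 hz.2, one_mul]
      | inv y _ hy => exact ⟨inv_mem hy.1, by rw [inv_pow]; exact inv_mem hy.2⟩
    exact key.2

/-- In a layer of prime exponent, each nontrivial element generates a cyclic layer. -/
lemma IsLayerGen.of_notMem {p : ℕ} (hp : p.Prime) (h2 : ∀ x : G, x ^ p ∈ gam G 2) {i : ℕ}
    (hi : 1 ≤ i) {e y : G} (h : IsLayerGen i e) (hy : y ∈ gam G i) (hy' : y ∉ gam G (i + 1)) :
    IsLayerGen i y := by
  refine ⟨hy, ?_⟩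
  obtain ⟨k, z, hz, rfl⟩ := mem_zpowers_sup (h.2 hy)
  have hep := pow_prime_mem_gam h2 hi h.1
  have hk : ¬ (p : ℤ) ∣ k := by
    rintro ⟨l, rfl⟩
    refine hy' (mul_mem ?_ hz)
    rw [zpow_mul]; exact zpow_mem (by simpa using hep) _
  have hcop : IsCoprime (p : ℤ) k := (Nat.prime_iff_prime_int.1 hp).coprime_iff_not_dvd.2 hk
  obtain ⟨u, v, huv⟩ := hcop
  refine h.2.trans (sup_le ?_ le_sup_right)
  have hek : e ^ k ∈ Subgroup.zpowers (e ^ k * z) ⊔ gam G (i + 1) := by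
    have := mul_mem (Subgroup.mem_sup_left (T := gam G (i + 1))
      (Subgroup.mem_zpowers (e ^ k * z))) (Subgroup.mem_sup_right (inv_mem hz))
    simpa using this
  have this' : e = (e ^ (p : ℤ)) ^ u * (e ^ k) ^ v := by
    rw [← zpow_mul, ← zpow_mul, ← zpow_add, mul_comm _ u, mul_comm _ v, huv, zpow_one]
  have he : e ∈ Subgroup.zpowers (e ^ k * z) ⊔ gam G (i + 1) := by
    have := mul_mem (zpow_mem (Subgroup.mem_sup_right (S := Subgroup.zpowers (e ^ k * z))
      (by simpa using hep : e ^ (p : ℤ) ∈ gam G (i + 1))) u) (zpow_mem hek v)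
    rwa [← this'] at this
  simpa using he

lemma gam_eq_bot_of_le [Group.IsNilpotent G] {i j : ℕ} (hi : 1 ≤ i) (h : gam G i ≤ gam G (i + 1))
    (hj : i ≤ j) : gam G j = ⊥ := by
  have hle : ∀ k, i ≤ k → gam G i ≤ gam G k := by
    intro k hk
    induction k, hk using Nat.le_induction with
    | base => exact le_rfl
    | succ k hk ih =>
      rw [gam_succ (by omega)]
      refine (h.trans (gam_succ hi).le).trans (Subgroup.commutator_mono ih le_rfl)
  obtain ⟨n, hn⟩ := Subgroup.nilpotent_iff_lowerCentralSeries.1 ‹Group.IsNilpotent G›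
  have hb : gam G i ≤ ⊥ := by
    refine (hle (i + n) (by omega)).trans ?_
    rw [← hn]
    exact Subgroup.lowerCentralSeries_antitone _ (by omega)
  exact le_bot_iff.1 ((gam_antitone hj).trans hb)

end LowerCentral

/-! ### Power structure and two-step centralizers beyond the first `p` layers -/

section PowerStructure

variable {G : Type*} [Group G]

lemma gam_shift_antitone (q : ℕ) : Antitone fun k => gam G (q + k) :=
  fun _ _ h => gam_antitone (Nat.add_le_add_left h q)

/-- Shifting by q ≥ 1 supplies the extra 1 in the commutator condition required for polynomial
sequences. -/
lemma gam_shift_commutator {q : ℕ} (hq : 1 ≤ q) (s t : ℕ) :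
    ⁅gam G (q + s), gam G (q + t)⁆ ≤ gam G (q + (s + t + 1)) :=
  (commutator_gam_le _ _).trans (gam_antitone (by omega))

lemma iterate_conjDiff_mem {i j : ℕ} {a x : G} (ha : a ∈ gam G i) (hx : x ∈ gam G j) (k : ℕ) :
    (conjDiff a)^[k] x ∈ gam G (j + k * i) := by
  induction k with
  | zero => simpa using hx
  | succ k ih =>
    rw [Function.iterate_succ_apply', show j + (k + 1) * i = j + k * i + i by ring]
    exact commutator_mem_gam (inv_mem ih) ha

lemma iterate_conjDiff_mem_shift {q j : ℕ} {x : G} (a : G) (hx : x ∈ gam G j) (hj : q + 1 ≤ j)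
    (k : ℕ) : (conjDiff a)^[k] x ∈ gam G (q + (k + 1)) :=
  mem_gam_of_le (by omega) (iterate_conjDiff_mem (mem_gam_one a) hx k)

variable {p q j : ℕ} {a x : G} {K : Subgroup G}

lemma isPolySeq_normSeq_gam (hx : x ∈ gam G j) (hj : q + 1 ≤ j) :
    IsPolySeq (fun k => gam G (q + k)) 0 (normSeq x a) :=
  isPolySeq_normSeq (gam_shift_antitone q) (fun _ => gam_normal _)
    (iterate_conjDiff_mem_shift a hx hj)

lemma mul_pow_prime_iff (hp : p.Prime) (hq : 1 ≤ q) (hx : x ∈ gam G j) (hj : q + 1 ≤ j)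
    (hK : gam G (q + (p + 1)) ≤ K) (hz : ∀ z ∈ gam G (q + 1), z ^ p ∈ K) :
    (x * a) ^ p * (a ^ p)⁻¹ ∈ K ↔ (conjDiff a)^[p - 1] x ∈ K := by
  obtain ⟨r, -, h1, h2⟩ := (isPolySeq_normSeq_gam (a := a) hx hj).newton_prime
    (gam_shift_antitone q) (fun _ => gam_normal _) (gam_shift_commutator hq) hp le_rfl hp.one_le hz
    (by intro i hi; obtain rfl : i = 0 := by omega
        simp [normSeq])
  obtain ⟨m, rfl⟩ := Nat.exists_eq_add_of_le' hp.one_le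
  rw [iterate_seqDiff_normSeq] at h2
  rw [show (x * a) ^ (m + 1) * (a ^ (m + 1))⁻¹ = normSeq x a (m + 1) from rfl, h1]
  have h3 := hK (QuotientGroup.eq.1 h2)
  constructor
  · intro h; simpa using mul_mem h h3
  · intro h; simpa using mul_mem h (inv_mem h3)

lemma mul_pow_prime_mem (hp : p.Prime) (hq : 1 ≤ q) (hx : x ∈ gam G j) (hj : q + 1 ≤ j)
    (hK : gam G (q + p) ≤ K) (hz : ∀ z ∈ gam G (q + 1), z ^ p ∈ K) :
    (x * a) ^ p * (a ^ p)⁻¹ ∈ K := by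
  obtain ⟨r, hr, h1, -⟩ := (isPolySeq_normSeq_gam (a := a) hx hj).newton_prime
    (gam_shift_antitone q) (fun _ => gam_normal _) (gam_shift_commutator hq) hp le_rfl hp.one_le hz
    (by intro i hi; obtain rfl : i = 0 := by omega
        simp [normSeq])
  exact h1.2 (hK hr)

/-- Removing x^n from the sequence first makes it vanish at both 0 and 1. Hence only p-th powers
from γ_{q+2} need be known, which suits a descending induction on weight. -/
lemma pow_prime_mem_of_mul_pow (hp : p.Prime) (hq : 1 ≤ q) (hx : x ∈ gam G j) (hj : q + 1 ≤ j)
    (hK : gam G (q + p) ≤ K) (hz : ∀ z ∈ gam G (q + 2), z ^ p ∈ K)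
    (h : (x * a) ^ p * (a ^ p)⁻¹ ∈ K) : x ^ p ∈ K := by
  have hB := isPolySeq_binomSeq (s := 0) (gam_shift_antitone (G := G) q) 1 (g := x)
    (mem_gam_of_le (by omega) hx)
  have hP := (hB.inv (gam_shift_antitone q) (gam_shift_commutator hq)).mul
    (gam_shift_antitone q) (gam_shift_commutator hq) (isPolySeq_normSeq_gam (a := a) hx hj)
  obtain ⟨r, hr, h1, -⟩ := hP.newton_prime
    (gam_shift_antitone q) (fun _ => gam_normal _) (gam_shift_commutator hq) hp one_le_two
    hp.two_le hz (by
      intro i hi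
      interval_cases i <;> simp [binomSeq, normSeq])
  have h2 := h1.2 (hK hr)
  have h3 : (x ^ p)⁻¹ * ((x * a) ^ p * (a ^ p)⁻¹) ∈ K := by
    simpa [binomSeq, normSeq] using h2
  simpa using (Subgroup.mul_mem_cancel_right K h).1 h3

end PowerStructure

/-! ### Extending the two-step centralizer from layers below n > p to layer n -/

section TwoStepCentralizers

variable {G : Type*} [Group G] {p n : ℕ} {a b : G}

lemma closure_pair_inv_right (hab : ⊤ ≤ Subgroup.closure {a, b} ⊔ gam G 2) :
    ⊤ ≤ Subgroup.closure {a, b⁻¹} ⊔ gam G 2 := by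
  refine hab.trans (sup_le_sup_right ((Subgroup.closure_le _).2 ?_) _)
  rintro x (rfl | rfl)
  · exact Subgroup.subset_closure (by simp)
  · exact inv_mem_iff.1 (Subgroup.subset_closure (by simp))

lemma isLayerGen_iterate_conjDiff (hab : ⊤ ≤ Subgroup.closure {a, b} ⊔ gam G 2)
    (hS : ∀ i, 2 ≤ i → i < n → ∀ x ∈ gam G i, ⁅x, b⁆ ∈ gam G (i + 2)) {k : ℕ} (hk : 1 ≤ k)
    (hkn : k + 1 ≤ n) : IsLayerGen (k + 1) ((conjDiff a)^[k] b) := by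
  induction k, hk using Nat.le_induction with
  | base => exact isLayerGen_two (closure_pair_inv_right hab)
  | succ k hk ih =>
    rw [Function.iterate_succ_apply']
    have h := (ih (by omega)).inv
    exact h.succ (by omega) hab (hS _ (by omega) (by omega) _ h.1)

/-- Here [w, a]a is the conjugate of a by w, so its p-th power is the conjugate of a^p. -/
lemma commutator_mul_pow (w : G) (p : ℕ) : (⁅w, a⁆ * a) ^ p * (a ^ p)⁻¹ = ⁅w, a ^ p⁆ := by
  rw [commutatorElement_def, inv_mul_cancel_right, conj_pow, commutatorElement_def]

/-- If a^p lay in γ_k but not in γ_{k+1} for some k < n, it would generate layer k, so [a^p, a] = 1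
would generate layer k + 1 and the series would stop before n. -/
lemma pow_prime_mem_gam_of_commutator_mem [Group.IsNilpotent G] (hp : p.Prime)
    (h2 : ∀ x : G, x ^ p ∈ gam G 2) (hab : ⊤ ≤ Subgroup.closure {a, b} ⊔ gam G 2)
    (hS : ∀ i, 2 ≤ i → i < n → ∀ x ∈ gam G i, ⁅x, b⁆ ∈ gam G (i + 2)) (hn : gam G n ≠ ⊥)
    {k : ℕ} (hk : 2 ≤ k) (hkn : k ≤ n) : a ^ p ∈ gam G k := by
  induction k, hk using Nat.le_induction with
  | base => exact h2 a
  | succ k hk ih =>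
    by_contra h
    obtain ⟨l, rfl⟩ := Nat.exists_eq_add_of_le' (show 1 ≤ k by omega)
    have h1 := (isLayerGen_iterate_conjDiff hab hS (k := l) (by omega) (by omega)).of_notMem hp h2
      (by omega) (ih (by omega)) h
    have h3 := (h1.succ (by omega) hab (hS _ hk (by omega) _ h1.1)).2
    rw [commutatorElement_eq_one_iff_commute.2 (Commute.pow_self a p), Subgroup.zpowers_one_eq_bot,
      bot_sup_eq] at h3
    exact hn (gam_eq_bot_of_le (by omega) h3 hkn)

/-- The `p`-th power map raises the weight by `p - 1`. -/
lemma pow_prime_mem_gam_add (hp : p.Prime) (h2 : ∀ x : G, x ^ p ∈ gam G 2)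
    (hab : ⊤ ≤ Subgroup.closure {a, b} ⊔ gam G 2)
    (hS : ∀ i, 2 ≤ i → i < n → ∀ x ∈ gam G i, ⁅x, b⁆ ∈ gam G (i + 2)) (ha : a ^ p ∈ gam G n)
    (d : ℕ) {j : ℕ} (hj : 3 ≤ j) (hd : n + 2 ≤ j + d) {x : G} (hx : x ∈ gam G j) :
    x ^ p ∈ gam G (min (j + p - 1) (n + 2)) := by
  have hp2 := hp.two_le
  induction d generalizing j x with
  | zero => exact pow_mem (mem_gam_of_le (by omega) hx) p
  | succ d ih =>
    rcases le_or_gt (n + 1) j with hjn | hjn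
    · exact mem_gam_of_le (by omega) (pow_prime_mem_gam h2 (by omega) hx)
    have ih' : ∀ z ∈ gam G (j + 1), z ^ p ∈ gam G (min (j + p - 1) (n + 2)) := fun z hz =>
      mem_gam_of_le (by omega) (ih (j := j + 1) (by omega) (by omega) hz)
    obtain ⟨l, rfl⟩ := Nat.exists_eq_add_of_le' (show 2 ≤ j by omega)
    have hgen := isLayerGen_iterate_conjDiff hab hS (k := l + 1) (by omega) (by omega)
    have hl := (isLayerGen_iterate_conjDiff hab hS (k := l) (by omega) (by omega)).1
    have hw : ((conjDiff a)^[l + 1] b) = ⁅((conjDiff a)^[l] b)⁻¹, a⁆ := by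
      rw [Function.iterate_succ_apply']; rfl
    set e := (conjDiff a)^[l + 1] b
    -- For e = [w, a] the lemma reduces to [w, a^p], which has weight at least l + 1 + n. This
    -- reaches n + 2 because j = l + 2 ≥ 3.
    have he : e ^ p ∈ gam G (min (l + 2 + p - 1) (n + 2)) := by
      refine pow_prime_mem_of_mul_pow (q := l + 1) (a := a) hp (by omega) hgen.1 (by omega)
        (gam_antitone (by omega)) (fun z hz => ih' z hz) ?_
      rw [hw, commutator_mul_pow]
      exact mem_gam_of_le (by omega) (commutator_mem_gam (inv_mem hl) ha)
    obtain ⟨k, z, hz, rfl⟩ := mem_zpowers_sup (hgen.2 hx)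
    have hz' : e ^ k * z * (e ^ k)⁻¹ ∈ gam G (l + 2 + 1) := (gam_normal _).conj_mem z hz _
    have h := mul_pow_prime_mem (q := l + 2) (a := e ^ k)
      (K := gam G (min (l + 2 + p - 1) (n + 2))) hp (by omega) hz' le_rfl
      (gam_antitone (by omega)) ih'
    have hek : (e ^ k) ^ p ∈ gam G (min (l + 2 + p - 1) (n + 2)) := by
      rw [← zpow_natCast, zpow_comm, zpow_natCast]; exact zpow_mem he k
    rw [inv_mul_cancel_right] at h
    simpa using mul_mem h hek

/-- If `b` centralizes the two-step sections up to `gam G n` with `p < n`, then also the next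
one. -/
theorem commutator_mem_gam_of_prime_lt [Group.IsNilpotent G] (hp : p.Prime)
    (h2 : ∀ x : G, x ^ p ∈ gam G 2) (hab : ⊤ ≤ Subgroup.closure {a, b} ⊔ gam G 2)
    (hS : ∀ i, 2 ≤ i → i < n → ∀ x ∈ gam G i, ⁅x, b⁆ ∈ gam G (i + 2)) (hpn : p < n) {x : G}
    (hx : x ∈ gam G n) : ⁅x, b⁆ ∈ gam G (n + 2) := by
  have hp2 := hp.two_le
  by_cases hbot : gam G n = ⊥
  · obtain rfl : x = 1 := by simpa [hbot] using hx
    simp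
  have ha : a ^ p ∈ gam G n :=
    pow_prime_mem_gam_of_commutator_mem hp h2 hab hS hbot (by omega) le_rfl
  obtain ⟨l, rfl⟩ := Nat.exists_eq_add_of_le (show p + 1 ≤ n by omega)
  -- Here [b, z^p] = ([b, z]z)^p z^{-p}, and [b, z] has weight at least l + 4, one more than
  -- generic. The rise of weight by p - 1 then gives l + p + 3 = n + 2.
  have hC : ∀ z ∈ gam G (l + 1 + 1), z ^ p ∈ centralizerMod (gam G (p + 1 + l + 2)) b := by
    intro z hz
    have hz' : ⁅b, z⁆ ∈ gam G (l + 2 + 2) := by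
      rw [← commutatorElement_inv]; exact inv_mem (hS _ (by omega) (by omega) z hz)
    have h := mul_pow_prime_mem (q := l + 3) (a := z) (K := gam G (p + 1 + l + 2)) hp (by omega)
      hz' (by omega) (gam_antitone (by omega)) (fun y hy => mem_gam_of_le (by omega)
        (pow_prime_mem_gam_add hp h2 hab hS ha (p + 1 + l + 2) (by omega) (by omega) hy))
    rw [mem_centralizerMod, ← commutatorElement_inv, inv_mem_iff]
    rwa [commutatorElement_def b z, inv_mul_cancel_right, conj_pow, ← commutatorElement_def] at h
  have hl : (conjDiff a)^[l] b ∈ gam G (l + 1) :=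
    mem_gam_of_le (by omega) (iterate_conjDiff_mem (mem_gam_one a) (mem_gam_one b) l)
  have hl1 : (conjDiff a)^[l + 1] b ∈ gam G (l + 1 + 1) :=
    mem_gam_of_le (by omega) (iterate_conjDiff_mem (mem_gam_one a) (mem_gam_one b) (l + 1))
  have hcen : ∀ y ∈ gam G (p + 1 + l + 1), y ∈ centralizerMod (gam G (p + 1 + l + 2)) b :=
    fun y hy => mem_centralizerMod.2 (mem_gam_of_le (by omega)
      (commutator_mem_gam hy (mem_gam_one b)))
  -- With x the (l + 1)-fold commutator, p - 1 further commutations reach weight exactly n = p + 1 +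
  -- l, so the surviving coefficient is a generator of layer n.
  have key := (mul_pow_prime_iff (q := l + 1) (a := a)
    (K := centralizerMod (gam G (p + 1 + l + 2)) b) hp (by omega) hl1 le_rfl
    (fun y hy => hcen y (mem_gam_of_le (by omega) hy)) hC).1 (by
      rw [Function.iterate_succ_apply', conjDiff, commutator_mul_pow]
      exact hcen _ (mem_gam_of_le (by omega) (commutator_mem_gam (inv_mem hl) ha)))
  rw [← Function.iterate_add_apply] at key
  have hgen := isLayerGen_iterate_conjDiff hab hS (k := p - 1 + (l + 1)) (by omega) (by omega)
  rw [show p - 1 + (l + 1) + 1 = p + 1 + l by omega] at hgen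
  exact hgen.commutator_mem (mem_centralizerMod.1 key) hx

end TwoStepCentralizers

/-! ### Two-step centralizers of the first `p` layers -/

section FirstLayers

variable {G : Type*} [Group G] {p n : ℕ} {a b : G}

/-- The left-normed commutators `⁅⁅⁅b, a⁆, a⁆, …⁆`. -/
def leftComm (a b : G) : ℕ → G
  | 0 => b
  | k + 1 => ⁅leftComm a b k, a⁆

lemma leftComm_mem (a b : G) (k : ℕ) : leftComm a b k ∈ gam G (k + 1) := by
  induction k with
  | zero => exact mem_gam_one b
  | succ k ih => exact commutator_mem_gam ih (mem_gam_one a)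

lemma isLayerGen_leftComm (hab : ⊤ ≤ Subgroup.closure {a, b} ⊔ gam G 2)
    (hS : ∀ i, 2 ≤ i → i < n → ∀ x ∈ gam G i, ⁅x, b⁆ ∈ gam G (i + 2)) {k : ℕ} (hk : 1 ≤ k)
    (hkn : k + 1 ≤ n) : IsLayerGen (k + 1) (leftComm a b k) := by
  induction k, hk using Nat.le_induction with
  | base => exact isLayerGen_two hab
  | succ k hk ih =>
    exact (ih (by omega)).succ (by omega) hab (hS _ (by omega) (by omega) _ (leftComm_mem a b k))

/-- Commutation with a acts as a derivation on the associated Lie ring: this is its Leibniz rule on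
a bracket of two left-normed commutators. -/
lemma gamMk_leftComm_mul (a b : G) {N k l : ℕ} (hN : k + l + 4 = N) :
    gamMk G N ⁅leftComm a b k, leftComm a b (l + 1)⁆ *
      gamMk G N ⁅leftComm a b (k + 1), leftComm a b l⁆ =
      gamMk G N ⁅⁅leftComm a b k, leftComm a b l⁆, a⁆ := by
  have hN' : k + 1 + (l + 1) + 1 + 1 = N := by omega
  subst hN'
  have hk := leftComm_mem a b k
  have hl := leftComm_mem a b l
  have h := gamMk_jacobi (by omega) (by omega) le_rfl hk hl (mem_gam_one a)
  have h1 : gamMk G (k + 1 + (l + 1) + 1 + 1) ⁅⁅a, leftComm a b k⁆, leftComm a b l⁆ =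
      (gamMk G (k + 1 + (l + 1) + 1 + 1) ⁅leftComm a b (k + 1), leftComm a b l⁆)⁻¹ := by
    have h2 := gamMk_commutator_zpow_left (leftComm_mem a b (k + 1)) hl (-1)
    rw [zpow_neg_one, zpow_neg_one, leftComm, commutatorElement_inv,
      show k + 1 + 1 + (l + 1) = k + 1 + (l + 1) + 1 by omega] at h2
    exact h2
  rw [h1, mul_inv_eq_one, ← commutatorElement_inv (leftComm a b k), map_inv,
    mul_inv_eq_iff_eq_mul] at h
  have hc : ⁅leftComm a b k, leftComm a b (l + 1)⁆ ∈ gam G (k + 1 + (l + 1) + 1) :=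
    mem_gam_of_le (by omega) (commutator_mem_gam hk (leftComm_mem a b (l + 1)))
  rw [h, (gamMk_commute hc _).eq]
  rfl

lemma leftComm_commutator_mem (hS : ∀ i, 2 ≤ i → i < n → ∀ x ∈ gam G i, ⁅x, b⁆ ∈ gam G (i + 2))
    {k l : ℕ} (hkl : k + l + 2 ≤ n) :
    ⁅leftComm a b k, leftComm a b l⁆ ∈ gam G (k + l + 3) := by
  induction k generalizing l with
  | zero =>
    cases l with
    | zero => simp
    | succ l =>
      rw [← commutatorElement_inv, inv_mem_iff]
      exact mem_gam_of_le (by omega) (hS _ (by omega) (by omega) _ (leftComm_mem a b (l + 1)))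
  | succ k ih =>
    have h := gamMk_leftComm_mul a b (k := k) (l := l) rfl
    rw [gamMk_eq_one.2 (mem_gam_of_le (by omega) (ih (l := l + 1) (by omega))), one_mul,
      gamMk_eq_one.2 (mem_gam_of_le (by omega)
        (commutator_mem_gam (ih (l := l) (by omega)) (mem_gam_one a))), gamMk_eq_one] at h
    exact mem_gam_of_le (by omega) h

/-- Write n = 2h + 1 and c_k for `leftComm a b k`. By the Leibniz rule [c_k, c_{2h-k}] changes only
by inversion, modulo γ_{n+2}, as k varies. It is trivial at k = h, hence also at k = 0, where it is
[b, c_{2h}]. -/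
theorem commutator_mem_gam_of_odd (hab : ⊤ ≤ Subgroup.closure {a, b} ⊔ gam G 2)
    (hS : ∀ i, 2 ≤ i → i < n → ∀ x ∈ gam G i, ⁅x, b⁆ ∈ gam G (i + 2)) (hn : 2 ≤ n)
    (hodd : Odd n) {x : G} (hx : x ∈ gam G n) : ⁅x, b⁆ ∈ gam G (n + 2) := by
  obtain ⟨h, rfl⟩ := hodd
  have key : ∀ d k, k + d = h →
      gamMk G (2 * h + 1 + 2) ⁅leftComm a b k, leftComm a b (2 * h - k)⁆ = 1 := by
    intro d
    induction d with
    | zero =>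
      intro k hk
      rw [show 2 * h - k = k by omega]; simp
    | succ d ih =>
      intro k hk
      have h1 := gamMk_leftComm_mul a b (N := 2 * h + 1 + 2) (k := k) (l := 2 * h - (k + 1))
        (by omega)
      rw [ih (k + 1) (by omega), mul_one,
        show 2 * h - (k + 1) + 1 = 2 * h - k by omega] at h1
      rw [h1, gamMk_eq_one]
      exact mem_gam_of_le (by omega) (commutator_mem_gam
        (leftComm_commutator_mem hS (k := k) (l := 2 * h - (k + 1)) (by omega)) (mem_gam_one a))
  have h0 := gamMk_eq_one.1 (key h 0 (by omega))
  refine (isLayerGen_leftComm hab hS (k := 2 * h) (by omega) le_rfl).commutator_mem ?_ hx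
  rw [← commutatorElement_inv, inv_mem_iff]
  exact h0

/-- If the two-step centralizer changes at an even layer below `p`, then the lower central series
stops two layers later. -/
theorem gam_le_succ_of_even (hp : p.Prime) (h2 : ∀ x : G, x ^ p ∈ gam G 2)
    (hab : ⊤ ≤ Subgroup.closure {a, b} ⊔ gam G 2)
    (hS : ∀ i, 2 ≤ i → i < n → ∀ x ∈ gam G i, ⁅x, b⁆ ∈ gam G (i + 2)) (hn : 3 ≤ n) (hnp : n < p)
    (heven : Even n) (ha : ∀ x ∈ gam G n, ⁅x, a⁆ ∈ gam G (n + 2)) :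
    gam G (n + 2) ≤ gam G (n + 3) := by
  obtain ⟨h, rfl⟩ := heven
  set A : ℕ → G := fun k => ⁅leftComm a b k, leftComm a b (h + h - 1 - k)⁆ with hA
  have hAm : ∀ k, k ≤ h → A k ∈ gam G (h + h + 1) := fun k hk =>
    mem_gam_of_le (by omega) (commutator_mem_gam (leftComm_mem a b k) (leftComm_mem a b _))
  set θ : ℕ → G ⧸ gam G (h + h + 3) := fun k => gamMk G (h + h + 3) ⁅A k, a⁆ with hθ
  -- The sum of A k and A (k + 1) is the commutator with a of a bracket already one layer deeper by
  -- hypothesis, so the signs alternate.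
  have hθs : ∀ k, k + 1 ≤ h → θ (k + 1) = (θ k)⁻¹ := by
    intro k hk
    have h1 := gamMk_leftComm_mul a b (N := h + h + 1 + 1) (k := k) (l := h + h - 1 - (k + 1))
      (by omega)
    rw [gamMk_of_mem (x := ⁅⁅leftComm a b k, leftComm a b (h + h - 1 - (k + 1))⁆, a⁆) (mem_gam_of_le (by omega) (commutator_mem_gam
      (leftComm_commutator_mem hS (by omega)) (mem_gam_one a))),
      show h + h - 1 - (k + 1) + 1 = h + h - 1 - k by omega] at h1
    have h3 : gamMk G (h + h + 1 + 1) (A (k + 1)) = gamMk G (h + h + 1 + 1) (A k)⁻¹ := by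
      rw [map_inv]; exact eq_inv_of_mul_eq_one_right h1
    have h4 := gamMk_commutator_left_congr (mem_gam_one a) h3
    have h5 := gamMk_commutator_zpow_left (hAm k (by omega)) (mem_gam_one a) (-1)
    rw [zpow_neg_one, zpow_neg_one] at h5
    exact h4.trans h5
  -- Additively B₀ = 0, since a centralizes layer n, and B_k + B_{k+1} = θ_k; with θ_{k+1} = -θ_k
  -- this solves to B_k = -kθ_k.
  have hB : ∀ k, k ≤ h → gamMk G (h + h + 3) ⁅leftComm a b k, leftComm a b (h + h - k)⁆ =
      (θ k)⁻¹ ^ k := by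
    intro k hk
    induction k with
    | zero =>
      rw [pow_zero, gamMk_eq_one, ← commutatorElement_inv, inv_mem_iff]
      obtain ⟨m, hm⟩ := Nat.exists_eq_add_of_le' (show 1 ≤ h + h by omega)
      have h1 : leftComm a b (h + h) ∈ gam G (h + h + 2) := by
        rw [hm]
        exact mem_gam_of_le (by omega) (ha _ (mem_gam_of_le (by omega) (leftComm_mem a b m)))
      exact mem_gam_of_le (by omega) (commutator_mem_gam h1 (mem_gam_one b))
    | succ k ih =>
      have h1 := gamMk_leftComm_mul a b (N := h + h + 3) (k := k) (l := h + h - (k + 1)) (by omega)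
      rw [show h + h - (k + 1) + 1 = h + h - k by omega, ih (by omega),
        show h + h - (k + 1) = h + h - 1 - k by omega] at h1
      have h3 : gamMk G (h + h + 3) ⁅⁅leftComm a b k, leftComm a b (h + h - 1 - k)⁆, a⁆ = θ k := rfl
      rw [h3, inv_pow, inv_mul_eq_iff_eq_mul, ← pow_succ] at h1
      rw [show h + h - (k + 1) = h + h - 1 - k by omega, h1, hθs k hk, inv_inv]
  -- At k = h the bracket is [c_h, c_h] = 1, so hθ_h = 0. As θ_h has exponent p and 0 < h < p, it
  -- vanishes.
  have hθh : θ h = 1 := by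
    have h1 := hB h le_rfl
    rw [show h + h - h = h by omega, commutatorElement_self, map_one, inv_pow, eq_comm,
      inv_eq_one] at h1
    have h3 : θ h ^ p = 1 := by
      rw [hθ, ← map_pow, gamMk_eq_one]
      exact mem_gam_of_le (by omega) (pow_prime_mem_gam h2 (by omega)
        (commutator_mem_gam (hAm h le_rfl) (mem_gam_one a)))
    have h4 : Nat.gcd h p = 1 := Nat.Coprime.symm
      (hp.coprime_iff_not_dvd.2 (Nat.not_dvd_of_pos_of_lt (by omega) (by omega)))
    have := pow_gcd_eq_one.2 ⟨h1, h3⟩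
    rwa [h4, pow_one] at this
  have hθ0 : θ 0 = 1 := by
    have : ∀ d k, k + d = h → θ k = 1 := by
      intro d
      induction d with
      | zero => intro k hk; obtain rfl : k = h := by omega
                exact hθh
      | succ d ih =>
        intro k hk
        have := hθs k (by omega)
        rw [ih (k + 1) (by omega), eq_comm, inv_eq_one] at this
        exact this
    exact this h 0 (by omega)
  obtain ⟨m, hm⟩ := Nat.exists_eq_add_of_le' (show 2 ≤ h + h by omega)
  have hgen : IsLayerGen (h + h) (leftComm a b (m + 1)) := by
    rw [hm]
    exact isLayerGen_leftComm hab hS (by omega) (by omega)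
  have hf : IsLayerGen (h + h + 1) ⁅leftComm a b (m + 1), b⁆ := by
    refine hgen.succ (by omega) ?_ (ha _ hgen.1)
    rwa [Set.pair_comm]
  refine hf.le_of_mem (by omega) hab le_rfl ?_ ?_
  · have h1 : ⁅A 0, a⁆ ∈ gam G (h + h + 3) := gamMk_eq_one.1 hθ0
    have h3 : A 0 = ⁅leftComm a b (m + 1), b⁆⁻¹ := by
      rw [commutatorElement_inv, hA]
      simp only [hm]
      rfl
    have h4 := gamMk_commutator_zpow_left hf.1 (mem_gam_one a) (-1)
    rw [zpow_neg_one, zpow_neg_one, ← h3, gamMk_eq_one.2 h1, eq_comm, inv_eq_one,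
      gamMk_eq_one] at h4
    exact h4
  -- For u = c_m, one Jacobi identity gives [[u, a], b] ≡ [[a, b], u]⁻¹. A second shows that
  -- commuting this with b is trivial, since [u, b] and [b, [a, b]] are each one layer deeper than
  -- generic.
  · rw [hm] at hf hS ⊢
    have hu := leftComm_mem a b m
    have hub : ⁅leftComm a b m, b⁆ ∈ gam G (m + 3) := hS _ (by omega) (by omega) _ hu
    have hbu : ⁅b, leftComm a b m⁆ ∈ gam G (m + 3) := by
      rw [← commutatorElement_inv]; exact inv_mem hub
    have hc : ⁅a, b⁆ ∈ gam G (1 + 1) := commutator_mem_gam (mem_gam_one a) (mem_gam_one b)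
    have hcb : ⁅b, ⁅a, b⁆⁆ ∈ gam G 4 := by
      rw [← commutatorElement_inv, inv_mem_iff]; exact hS 2 le_rfl (by omega) _ hc
    have j1 := gamMk_jacobi (by omega) le_rfl le_rfl hu (mem_gam_one a) (mem_gam_one b)
    rw [gamMk_of_mem (x := ⁅⁅b, leftComm a b m⁆, a⁆) (mem_gam_of_le (by omega) (commutator_mem_gam
      hbu (mem_gam_one a))), mul_one] at j1
    have j2 := gamMk_jacobi (by omega) (by omega) le_rfl hc hu (mem_gam_one b)
    rw [gamMk_of_mem (x := ⁅⁅leftComm a b m, b⁆, ⁅a, b⁆⁆) (mem_gam_of_le (by omega) (commutator_mem_gam hub hc)),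
      gamMk_of_mem (x := ⁅⁅b, ⁅a, b⁆⁆, leftComm a b m⁆) (mem_gam_of_le (by omega) (commutator_mem_gam hcb hu)),
      mul_one, mul_one] at j2
    have hcu := commutator_mem_gam hc hu
    have j3 : gamMk G (m + 1 + 1 + 1 + 1) ⁅leftComm a b (m + 1), b⁆ =
        gamMk G (m + 1 + 1 + 1 + 1) ⁅⁅a, b⁆, leftComm a b m⁆⁻¹ := by
      rw [map_inv]; exact eq_inv_of_mul_eq_one_left j1
    have j4 := gamMk_commutator_left_congr (mem_gam_one b) j3
    have j5 := gamMk_commutator_zpow_left hcu (mem_gam_one b) (-1)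
    rw [zpow_neg_one, zpow_neg_one, j2, inv_one] at j5
    rw [gamMk_eq_one] at j5
    rw [gamMk_of_mem (x := ⁅⁅⁅a, b⁆, leftComm a b m⁆⁻¹, b⁆) (mem_gam_of_le (by omega) j5), gamMk_eq_one] at j4
    exact mem_gam_of_le (by omega) j4

lemma closure_pair_mul_zpow (hab : ⊤ ≤ Subgroup.closure {a, b} ⊔ gam G 2) (k : ℤ) :
    ⊤ ≤ Subgroup.closure {a * b ^ k, b} ⊔ gam G 2 := by
  refine hab.trans (sup_le_sup_right ((Subgroup.closure_le _).2 ?_) _)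
  have hb : b ∈ Subgroup.closure {a * b ^ k, b} := Subgroup.subset_closure (by simp)
  rintro x (rfl | rfl)
  · have := mul_mem (Subgroup.subset_closure (by simp) : x * b ^ k ∈ Subgroup.closure
      {x * b ^ k, b}) (inv_mem (zpow_mem hb k))
    simpa using this
  · exact hb

/-- If the next layer is cyclic of prime order, some `a * b ^ k` centralizes `e` modulo that
layer's successor. -/
lemma IsLayerGen.exists_commutator_mem (hp : p.Prime) (h2 : ∀ x : G, x ^ p ∈ gam G 2)
    {i : ℕ} {e c : G} (he : e ∈ gam G i) (hc : IsLayerGen (i + 1) c) (a : G)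
    (hb : ⁅e, b⁆ ∉ gam G (i + 2)) : ∃ k : ℤ, ⁅e, a * b ^ k⁆ ∈ gam G (i + 2) := by
  have h := hc.of_notMem hp h2 (by omega) (commutator_mem_gam he (mem_gam_one b)) hb
  obtain ⟨k, z, hz, hk⟩ := mem_zpowers_sup (h.2 (commutator_mem_gam he (mem_gam_one a)))
  refine ⟨-k, ?_⟩
  have h1 := gamMk_commutator_mul_right a he (zpow_mem (mem_gam_one b) (-k))
  rw [gamMk_commutator_zpow_right he (mem_gam_one b), ← hk, map_mul, gamMk_eq_one.2 hz, mul_one,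
    map_zpow, ← zpow_add, add_neg_cancel, zpow_zero, gamMk_eq_one] at h1
  exact h1

/-- A square g² outside γ₃ generates layer 2 and commutes with g, so g serves. If a² and b² both lie
in γ₃, expanding [b, a²] and [b², a] shows that a and b act equally on layer 2 modulo γ₄, so ab⁻¹
serves. -/
lemma exists_commutator_mem_of_two (h2 : ∀ x : G, x ^ 2 ∈ gam G 2)
    (hab : ⊤ ≤ Subgroup.closure {a, b} ⊔ gam G 2) :
    ∃ a b : G, ⊤ ≤ Subgroup.closure {a, b} ⊔ gam G 2 ∧ ∀ x ∈ gam G 2, ⁅x, b⁆ ∈ gam G (2 + 2) := by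
  have hgen := isLayerGen_two hab
  have hab' : ⊤ ≤ Subgroup.closure {b, a} ⊔ gam G 2 := by rwa [Set.pair_comm]
  have key : ∀ g : G, g ^ 2 ∉ gam G 3 → ∀ x ∈ gam G 2, ⁅x, g⁆ ∈ gam G (2 + 2) := by
    intro g hg x hx
    refine (hgen.of_notMem Nat.prime_two h2 (by omega) (h2 g) hg).commutator_mem ?_ hx
    rw [commutatorElement_eq_one_iff_commute.2 (Commute.pow_self g 2)]
    exact one_mem _
  by_cases ha2 : a ^ 2 ∈ gam G 3
  swap
  · exact ⟨b, a, hab', key a ha2⟩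
  by_cases hb2 : b ^ 2 ∈ gam G 3
  swap
  · exact ⟨a, b, hab, key b hb2⟩
  refine ⟨b, a * b ^ (-1 : ℤ), ?_, fun x hx => hgen.commutator_mem ?_ hx⟩
  · rw [Set.pair_comm]; exact closure_pair_mul_zpow hab _
  have e1 : ⁅b, a ^ 2⁆ = ⁅b, a⁆ * ⁅a, ⁅b, a⁆⁆ * ⁅b, a⁆ := by
    simp only [commutatorElement_def, pow_two]; group
  have e2 : ⁅b ^ 2, a⁆ = ⁅b, ⁅b, a⁆⁆ * ⁅b, a⁆ * ⁅b, a⁆ := by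
    simp only [commutatorElement_def, pow_two]; group
  have hac : ⁅a, ⁅b, a⁆⁆ ∈ gam G 3 := commutator_mem_gam (mem_gam_one a) hgen.1
  have m1 := congrArg (gamMk G (3 + 1)) e1
  have m2 := congrArg (gamMk G (3 + 1)) e2
  rw [gamMk_eq_one.2 (commutator_mem_gam (mem_gam_one b) ha2 : ⁅b, a ^ 2⁆ ∈ gam G (1 + 3)),
    map_mul, map_mul, (gamMk_commute hac ⁅b, a⁆).symm.eq] at m1
  rw [gamMk_eq_one.2 (commutator_mem_gam hb2 (mem_gam_one a)), map_mul, map_mul, m1,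
    mul_left_inj, mul_left_inj, ← commutatorElement_inv, map_inv, ← commutatorElement_inv ⁅b, a⁆ b,
    map_inv, inv_inj] at m2
  have h1 := gamMk_commutator_mul_right a hgen.1 (zpow_mem (mem_gam_one b) (-1))
  rw [gamMk_commutator_zpow_right hgen.1 (mem_gam_one b), zpow_neg_one (gamMk _ _ _)] at h1
  rw [← gamMk_eq_one]
  exact h1.trans (by rw [mul_inv_eq_one]; exact m2)

/-- If the first `p` layers are cyclic, then either the lower central series stops at the next one,
or a single element centralizes all the two-step sections of the first layers. -/
theorem exists_two_step_centralizer [Group.IsNilpotent G] (hp : p.Prime)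
    (h2 : ∀ x : G, x ^ p ∈ gam G 2) (hab : ⊤ ≤ Subgroup.closure {a, b} ⊔ gam G 2)
    (hcyc : ∀ i, 2 ≤ i → i ≤ p → ∃ e : G, IsLayerGen i e) :
    gam G (p + 1) = ⊥ ∨ ∃ a b : G, ⊤ ≤ Subgroup.closure {a, b} ⊔ gam G 2 ∧
      ∀ i, 2 ≤ i → i < p + 1 → ∀ x ∈ gam G i, ⁅x, b⁆ ∈ gam G (i + 2) := by
  rcases hp.eq_two_or_odd' with rfl | hodd
  · obtain ⟨a, b, hab, h⟩ := exists_commutator_mem_of_two h2 hab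
    refine Or.inr ⟨a, b, hab, fun i h1 h3 => ?_⟩
    obtain rfl : i = 2 := by omega
    exact h
  have hp3 : 3 ≤ p := by
    have := hp.two_le
    obtain ⟨k, rfl⟩ := hodd
    omega
  obtain ⟨a, b, hab, hb⟩ : ∃ a b : G, ⊤ ≤ Subgroup.closure {a, b} ⊔ gam G 2 ∧
      ∀ x ∈ gam G 2, ⁅x, b⁆ ∈ gam G (2 + 2) := by
    have hgen := isLayerGen_two hab
    by_cases hb : ⁅⁅b, a⁆, b⁆ ∈ gam G (2 + 2)
    · exact ⟨a, b, hab, fun x hx => hgen.commutator_mem hb hx⟩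
    obtain ⟨c, hc⟩ := hcyc 3 (by omega) hp3
    obtain ⟨k, hk⟩ := IsLayerGen.exists_commutator_mem hp h2 hgen.1 hc a hb
    refine ⟨b, a * b ^ k, ?_, fun x hx => hgen.commutator_mem hk hx⟩
    rw [Set.pair_comm]; exact closure_pair_mul_zpow hab k
  have key : ∀ n, 3 ≤ n → n ≤ p + 1 → gam G (p + 1) = ⊥ ∨
      ∀ i, 2 ≤ i → i < n → ∀ x ∈ gam G i, ⁅x, b⁆ ∈ gam G (i + 2) := by
    intro n hn
    induction n, hn using Nat.le_induction with
    | base =>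
      refine fun _ => Or.inr fun i h1 h3 => ?_
      obtain rfl : i = 2 := by omega
      exact hb
    | succ n hn ih =>
      intro hnp
      refine (ih (by omega)).elim Or.inl fun hS => ?_
      have hstep : (∀ x ∈ gam G n, ⁅x, b⁆ ∈ gam G (n + 2)) →
          ∀ i, 2 ≤ i → i < n + 1 → ∀ x ∈ gam G i, ⁅x, b⁆ ∈ gam G (i + 2) := by
        intro h i h1 h3
        rcases Nat.lt_succ_iff_lt_or_eq.1 h3 with h4 | rfl
        · exact hS i h1 h4
        · exact h
      rcases Nat.even_or_odd n with heven | hnodd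
      swap
      · exact Or.inr (hstep fun x hx => commutator_mem_gam_of_odd hab hS (by omega) hnodd hx)
      have hlt : n < p := by
        refine lt_of_le_of_ne (by omega) ?_
        rintro rfl
        exact Nat.not_even_iff_odd.2 hodd heven
      obtain ⟨e, he⟩ := hcyc n (by omega) (by omega)
      by_cases heb : ⁅e, b⁆ ∈ gam G (n + 2)
      · exact Or.inr (hstep fun x hx => he.commutator_mem heb hx)
      obtain ⟨c, hc⟩ := hcyc (n + 1) (by omega) (by omega)
      obtain ⟨k, hk⟩ := IsLayerGen.exists_commutator_mem hp h2 he.1 hc a heb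
      have h := gam_le_succ_of_even hp h2 (closure_pair_mul_zpow hab k) hS hn hlt heven
        fun x hx => he.commutator_mem hk hx
      -- The series stops at n + 2 ≤ p + 1, because n < p.
      exact Or.inl (gam_eq_bot_of_le (by omega) h (by omega))
  rcases key (p + 1) (by omega) le_rfl with h | h
  · exact Or.inl h
  · exact Or.inr ⟨a, b, hab, h⟩

/-- If the first `p` layers are cyclic, then all the layers are. -/
theorem exists_isLayerGen [Group.IsNilpotent G] (hp : p.Prime)
    (h2 : ∀ x : G, x ^ p ∈ gam G 2) (hab : ⊤ ≤ Subgroup.closure {a, b} ⊔ gam G 2)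
    (hcyc : ∀ i, 2 ≤ i → i ≤ p → ∃ e : G, IsLayerGen i e) {i : ℕ} (hi : 2 ≤ i) :
    ∃ e : G, IsLayerGen i e := by
  rcases le_or_gt i p with hip | hip
  · exact hcyc i hi hip
  rcases exists_two_step_centralizer hp h2 hab hcyc with hbot | ⟨a, b, hab, hS⟩
  · have h : gam G i ≤ ⊥ := hbot ▸ gam_antitone (by omega)
    exact ⟨1, one_mem _, h.trans bot_le⟩
  have hall : ∀ n, p + 1 ≤ n →
      ∀ i, 2 ≤ i → i < n → ∀ x ∈ gam G i, ⁅x, b⁆ ∈ gam G (i + 2) := by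
    intro n hn
    induction n, hn using Nat.le_induction with
    | base => exact hS
    | succ n hn ih =>
      intro i h1 h3 x hx
      rcases Nat.lt_succ_iff_lt_or_eq.1 h3 with h4 | rfl
      · exact ih i h1 h4 x hx
      · exact commutator_mem_gam_of_prime_lt hp h2 hab ih (by omega) hx
  obtain ⟨k, rfl⟩ := Nat.exists_eq_add_of_le' (show 1 ≤ i by omega)
  exact ⟨_, isLayerGen_leftComm hab (hall (k + 1) (by omega)) (by omega) le_rfl⟩

end FirstLayers

/-! ### Counting normal subgroups of small index -/

section Counting

variable {G : Type*} [Group G] {p m : ℕ}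

lemma relIndex_zpowers_sup_dvd {N : Subgroup G} [N.Normal] {x : G} {k : ℕ} (hx : x ^ k ∈ N) :
    N.relIndex (Subgroup.zpowers x ⊔ N) ∣ k := by
  rw [Subgroup.relIndex_sup_right]
  have h := Subgroup.relIndex_ker (Subgroup.zpowers x) (QuotientGroup.mk' N)
  rw [QuotientGroup.ker_mk'] at h
  rw [h, MonoidHom.map_zpowers, Nat.card_zpowers, orderOf_dvd_iff_pow_eq_one, ← map_pow]
  exact (QuotientGroup.eq_one_iff _).2 hx

lemma eq_of_le_of_index_eq [Finite G] {H K : Subgroup G} (h : H ≤ K) (hi : H.index = K.index) :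
    H = K := by
  refine le_antisymm h (Subgroup.relIndex_eq_one.1 ?_)
  have h1 := Subgroup.relIndex_mul_index h
  rw [hi] at h1
  exact Nat.eq_of_mul_eq_mul_right (Nat.pos_of_ne_zero Subgroup.index_ne_zero_of_finite)
    (h1.trans (one_mul _).symm)

lemma exists_le_index_eq [Finite G] (hp : p.Prime) (hcard : Nat.card G = p ^ m) {H : Subgroup G}
    {k : ℕ} (hk : p ^ k ∣ H.index) : ∃ K : Subgroup G, H ≤ K ∧ K.index = p ^ k := by
  have : Fact p.Prime := ⟨hp⟩
  have hHi : H.index ∣ p ^ m := hcard ▸ H.index_dvd_card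
  obtain ⟨s, -, hs⟩ := (Nat.dvd_prime_pow hp).1 hHi
  obtain ⟨t, -, ht⟩ := (Nat.dvd_prime_pow hp).1 (hcard ▸ H.card_subgroup_dvd_card)
  have hst : t + s = m := by
    have := H.card_mul_index
    rw [ht, hs, hcard, ← pow_add] at this
    exact Nat.pow_right_injective hp.two_le this
  have hks : k ≤ s := (Nat.pow_dvd_pow_iff_le_right hp.one_lt).1 (hs ▸ hk)
  obtain ⟨K, hK, hHK⟩ := Sylow.exists_subgroup_card_pow_prime_le p (n := t) (m := m - k)
    (hcard ▸ pow_dvd_pow p (by omega)) H ht (by omega)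
  refine ⟨K, hHK, ?_⟩
  have h1 := K.card_mul_index
  have h2 : p ^ m = p ^ (m - k) * p ^ k := by rw [← pow_add, Nat.sub_add_cancel (by omega)]
  rw [hK, hcard, h2] at h1
  exact Nat.eq_of_mul_eq_mul_left (pow_pos hp.pos _) h1

lemma exists_between_relIndex_eq [Finite G] (hp : p.Prime) (hcard : Nat.card G = p ^ m)
    {H L : Subgroup G} {k : ℕ} (hk : p ^ k ∣ H.relIndex L) (hHL : H ≤ L) :
    ∃ K : Subgroup G, H ≤ K ∧ K ≤ L ∧ K.relIndex L = p ^ k := by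
  obtain ⟨t, -, ht⟩ := (Nat.dvd_prime_pow hp).1 (hcard ▸ L.card_subgroup_dvd_card)
  obtain ⟨K, hK, hKi⟩ := exists_le_index_eq hp ht hk
  refine ⟨K.map L.subtype, ?_, Subgroup.map_subtype_le K, ?_⟩
  · rw [← Subgroup.map_subgroupOf_eq_of_le hHL]
    exact Subgroup.map_mono hK
  · rw [Subgroup.relIndex, Subgroup.subgroupOf, Subgroup.comap_map_eq_self_of_injective
      L.subtype_injective, hKi]

lemma commutative_of_zpowers_sup_gam [Group.IsNilpotent G] {x : G}
    (hx : Subgroup.zpowers x ⊔ gam G 2 = ⊤) (a b : G) : a * b = b * a := by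
  have hab : ⊤ ≤ Subgroup.closure {x, x} ⊔ gam G 2 := by
    rw [Set.pair_eq_singleton, ← Subgroup.zpowers_eq_closure, hx]
  have h := (isLayerGen_two hab).2
  rw [commutatorElement_self, Subgroup.zpowers_one_eq_bot, bot_sup_eq] at h
  have hbot := gam_eq_bot_of_le (by omega) h le_rfl
  have h1 := commutator_mem_gam (mem_gam_one a) (mem_gam_one b)
  rw [hbot, Subgroup.mem_bot, commutatorElement_eq_one_iff_mul_comm] at h1
  exact h1

/-- Subgroups containing γ₂ are normal, so those of index at least p² all lie in U, and any x
outside U generates with γ₂ a subgroup of index p. Finding such an x with x^p ∈ γ₂ bounds |G : γ₂|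
by p². -/
lemma gam_two_of_existsUnique [Finite G] [Group.IsNilpotent G] (hp : p.Prime)
    (hcard : Nat.card G = p ^ m) (hnonab : ¬ ∀ a b : G, a * b = b * a)
    (huniq : ∃! N : Subgroup G, N.Normal ∧ N.index = p ^ 2) :
    (gam G 2).index = p ^ 2 ∧ (∀ x : G, x ^ p ∈ gam G 2) ∧
      ∃ a b : G, ⊤ ≤ Subgroup.closure {a, b} ⊔ gam G 2 := by
  obtain ⟨U, ⟨hUn, hUi⟩, hU⟩ := huniq
  set W : G → Subgroup G := fun x => Subgroup.zpowers x ⊔ gam G 2 with hWdef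
  have hxW : ∀ x, x ∈ W x := fun x => Subgroup.mem_sup_left (Subgroup.mem_zpowers x)
  have hgW : ∀ x, gam G 2 ≤ W x := fun x => le_sup_right
  have hWle : ∀ {x : G} {H : Subgroup G}, x ∈ H → gam G 2 ≤ H → W x ≤ H := fun hx hH =>
    sup_le (by simpa using hx) hH
  have hWtop : ∀ x, W x ≠ ⊤ := fun x hx => hnonab (commutative_of_zpowers_sup_gam hx)
  have hWn : ∀ x, (W x).Normal := fun x => normal_of_gam_le le_rfl (hgW x) le_top
  have hindex : ∀ H : Subgroup G, ∃ k, H.index = p ^ k := fun H => by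
    obtain ⟨k, -, hk⟩ := (Nat.dvd_prime_pow hp).1 (hcard ▸ H.index_dvd_card)
    exact ⟨k, hk⟩
  have hleU : ∀ H : Subgroup G, gam G 2 ≤ H → p ^ 2 ∣ H.index → H ≤ U := by
    intro H hH h
    obtain ⟨K, hHK, hK⟩ := exists_le_index_eq hp hcard h
    rw [← hU K ⟨normal_of_gam_le le_rfl (hH.trans hHK) le_top, hK⟩]
    exact hHK
  have hWU : ∀ x, x ∉ U → (W x).index = p := by
    intro x hx
    obtain ⟨k, hk⟩ := hindex (W x)
    have hk2 : k < 2 := by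
      by_contra h
      exact hx (hleU _ (hgW x) (hk ▸ pow_dvd_pow p (by omega)) (hxW x))
    interval_cases k
    · exact absurd (Subgroup.index_eq_one.1 (by simpa using hk)) (hWtop x)
    · simpa using hk
  have hgU : gam G 2 ≤ U := by
    refine hleU _ le_rfl ?_
    obtain ⟨k, hk⟩ := hindex (gam G 2)
    rw [hk]
    refine pow_dvd_pow p ?_
    by_contra h
    have hne : gam G 2 ≠ ⊤ := fun h => hWtop 1 (top_le_iff.1 (h ▸ hgW 1))
    obtain ⟨x, hx⟩ : ∃ x, x ∉ gam G 2 := by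
      by_contra! hx
      exact hne (eq_top_iff.2 fun x _ => hx x)
    have hk1 : k = 1 := by
      interval_cases k
      · exact absurd (Subgroup.index_eq_one.1 (by simpa using hk)) hne
      · rfl
    rw [hk1, pow_one] at hk
    have hd : (W x).index ∣ p := hk ▸ Subgroup.index_dvd_of_le (hgW x)
    rcases (Nat.dvd_prime hp).1 hd with h1 | h1
    · exact hWtop x (Subgroup.index_eq_one.1 h1)
    · exact hx ((eq_of_le_of_index_eq (hgW x) (hk.trans h1.symm)).symm ▸ hxW x)
  have hUtop : U ≠ ⊤ := by
    rintro rfl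
    rw [Subgroup.index_top] at hUi
    exact (Nat.one_lt_pow two_ne_zero hp.one_lt).ne hUi
  obtain ⟨g, hg⟩ : ∃ g, g ∉ U := by
    by_contra! h
    exact hUtop (eq_top_iff.2 fun x _ => h x)
  obtain ⟨h, hh, hhU⟩ : ∃ h, h ∉ W g ∧ h ∉ U := by
    obtain ⟨h, hh⟩ : ∃ h, h ∉ W g := by
      by_contra! h
      exact hWtop g (eq_top_iff.2 fun x _ => h x)
    by_cases hhU : h ∈ U
    · exact ⟨g * h, fun h1 => hh ((Subgroup.mul_mem_cancel_left _ (hxW g)).1 h1),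
        fun h1 => hg ((Subgroup.mul_mem_cancel_right _ hhU).1 h1)⟩
    · exact ⟨h, hh, hhU⟩
  have hWg := hWU g hg
  have hWh := hWU h hhU
  have hgWh : g ∉ W h := fun h1 => hh
    ((eq_of_le_of_index_eq (hWle h1 (hgW h)) (hWg.trans hWh.symm)).symm ▸ hxW h)
  have htop : W h ⊔ W g = ⊤ := by
    have hd : (W h ⊔ W g).index ∣ p := hWg ▸ Subgroup.index_dvd_of_le le_sup_right
    rcases (Nat.dvd_prime hp).1 hd with h1 | h1
    · exact Subgroup.index_eq_one.1 h1
    · have := eq_of_le_of_index_eq (le_sup_right : W g ≤ W h ⊔ W g) (hWg.trans h1.symm)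
      exact absurd (this.symm ▸ Subgroup.mem_sup_left (hxW h)) hh
  have hinf : W g ⊓ W h = U := by
    refine hU _ ⟨inferInstance, ?_⟩
    rw [← Subgroup.relIndex_mul_index (inf_le_right : W g ⊓ W h ≤ W h),
      Subgroup.inf_relIndex_right, ← Subgroup.relIndex_sup_right, htop, Subgroup.relIndex_top_right,
      hWg, hWh, pow_two]
  have hpow : ∀ x, x ∉ U → U ≤ W x → x ^ p ∈ U := by
    intro x hx hUx
    have h1 := Subgroup.relIndex_mul_index hUx
    rw [hUi, hWU x hx, pow_two] at h1
    rw [← Nat.eq_of_mul_eq_mul_right hp.pos h1]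
    exact Subgroup.pow_relIndex_mem _ (hxW x)
  have hgp : g ^ p ∈ U := hpow g hg (hinf ▸ inf_le_left)
  have hhp : h ^ p ∈ U := hpow h hhU (hinf ▸ inf_le_right)
  have hUWh : U ≤ W h := hinf ▸ inf_le_right
  -- Modulo γ₂, g^p is a power h^t. If p did not divide t, then h^p and h^t in U would put h in U.
  -- So t = pr, and gh^{-r} is the required element.
  obtain ⟨t, z, hz, htz⟩ := mem_zpowers_sup (hUWh hgp)
  have hpt : (p : ℤ) ∣ t := by
    by_contra hpt
    obtain ⟨u, v, huv⟩ := (Nat.prime_iff_prime_int.1 hp).coprime_iff_not_dvd.2 hpt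
    have hht : h ^ t ∈ U := by
      rw [eq_mul_inv_of_mul_eq htz]
      exact mul_mem hgp (inv_mem (hgU hz))
    refine hhU ?_
    have : h = (h ^ (p : ℤ)) ^ u * (h ^ t) ^ v := by
      rw [← zpow_mul, ← zpow_mul, ← zpow_add, mul_comm _ u, mul_comm _ v, huv, zpow_one]
    rw [this]
    exact mul_mem (zpow_mem (by simpa using hhp) _) (zpow_mem hht _)
  obtain ⟨r, rfl⟩ := hpt
  have hyU : g * h ^ (-r) ∉ U := by
    intro hy
    exact hgWh ((Subgroup.mul_mem_cancel_right _ (zpow_mem (hxW h) _)).1 (hUWh hy))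
  have hyp : (g * h ^ (-r)) ^ p ∈ gam G 2 := by
    rw [← gamMk_eq_one, map_pow, map_mul, (gamMk_commute (k := 1) (mem_gam_one g) _).mul_pow,
      ← map_pow, ← map_pow, ← htz, map_mul, gamMk_of_mem hz, mul_one, ← map_mul,
      ← zpow_natCast, ← zpow_mul, ← zpow_add]
    have : (p : ℤ) * r + -r * p = 0 := by ring
    rw [this]; simp
  have hg2 : (gam G 2).index = p ^ 2 := by
    refine Nat.dvd_antisymm ?_ (hUi ▸ Subgroup.index_dvd_of_le hgU)
    rw [← Subgroup.relIndex_mul_index (hgW (g * h ^ (-r))), hWU _ hyU, pow_two]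
    exact Nat.mul_dvd_mul_right (relIndex_zpowers_sup_dvd hyp) p
  have hgamU : gam G 2 = U := eq_of_le_of_index_eq hgU (hg2.trans hUi.symm)
  refine ⟨hg2, fun x => ?_, g, h, ?_⟩
  · by_cases hx : x ∈ U
    · rw [hgamU]; exact pow_mem hx p
    · rw [hgamU]; exact hpow x hx (hgamU ▸ hgW x)
  · rw [← htop]
    refine sup_le (hWle (Subgroup.mem_sup_left (Subgroup.subset_closure (by simp))) le_sup_right)
      (hWle (Subgroup.mem_sup_left (Subgroup.subset_closure (by simp))) le_sup_right)

/-- Take e in γ_i outside the unique U. If e did not generate the layer, a subgroup of index p in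
γ_i containing e and γ_{i+1} would be normal of index p^{i+1}, hence equal to U. -/
lemma exists_isLayerGen_of_existsUnique [Finite G] (hp : p.Prime) (hcard : Nat.card G = p ^ m)
    {i : ℕ} (hi : 1 ≤ i) (hindex : (gam G i).index = p ^ i)
    (huniq : ∃! N : Subgroup G, N.Normal ∧ N.index = p ^ (i + 1)) :
    ∃ e : G, IsLayerGen i e := by
  obtain ⟨U, ⟨hUn, hUi⟩, hU⟩ := huniq
  have hnot : ¬ gam G i ≤ U := by
    intro h
    have := Subgroup.index_dvd_of_le h
    rw [hUi, hindex, Nat.pow_dvd_pow_iff_le_right hp.one_lt] at this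
    omega
  obtain ⟨e, he, heU⟩ := SetLike.not_le_iff_exists.1 hnot
  refine ⟨e, he, ?_⟩
  by_contra hlt
  have hle : Subgroup.zpowers e ⊔ gam G (i + 1) ≤ gam G i :=
    sup_le (by simpa using he) (gam_antitone (Nat.le_succ i))
  have hdvd : p ^ 1 ∣ (Subgroup.zpowers e ⊔ gam G (i + 1)).relIndex (gam G i) := by
    obtain ⟨k, -, hk⟩ := (Nat.dvd_prime_pow hp).1
      (((Subgroup.relIndex_dvd_index_of_le hle).trans (Subgroup.index_dvd_card _)).trans hcard.dvd)
    rw [hk]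
    refine pow_dvd_pow p (Nat.one_le_iff_ne_zero.2 ?_)
    rintro rfl
    exact hlt (Subgroup.relIndex_eq_one.1 (by simpa using hk))
  obtain ⟨K, hHK, hKL, hK⟩ := exists_between_relIndex_eq hp hcard hdvd hle
  have hKU : K = U := by
    refine hU K ⟨normal_of_gam_le hi (le_sup_right.trans hHK) hKL, ?_⟩
    rw [← Subgroup.relIndex_mul_index hKL, hK, hindex, ← pow_add, add_comm]
  exact heU (hKU ▸ hHK (Subgroup.mem_sup_left (Subgroup.mem_zpowers e)))

lemma IsLayerGen.index_succ [Group.IsNilpotent G] (hp : p.Prime) (h2 : ∀ x : G, x ^ p ∈ gam G 2)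
    {i : ℕ} {e : G} (h : IsLayerGen i e) (hi : 1 ≤ i) (hne : gam G i ≠ ⊥)
    (hindex : (gam G i).index = p ^ i) : (gam G (i + 1)).index = p ^ (i + 1) := by
  have heq : Subgroup.zpowers e ⊔ gam G (i + 1) = gam G i :=
    le_antisymm (sup_le (by simpa using h.1) (gam_antitone (Nat.le_succ i))) h.2
  have hd := relIndex_zpowers_sup_dvd (pow_prime_mem_gam h2 hi h.1)
  rw [heq] at hd
  rw [← Subgroup.relIndex_mul_index (gam_antitone (Nat.le_succ i)), hindex]
  rcases (Nat.dvd_prime hp).1 hd with h1 | h1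
  · exact absurd (gam_eq_bot_of_le hi (Subgroup.relIndex_eq_one.1 h1) le_rfl) hne
  · rw [h1, pow_succ']

end Counting

/-! ### Assembly: from cyclic layers to maximal class -/

theorem proposition3p3 {p : ℕ} (hp : p.Prime) {m : ℕ} (hm : p ^ p < p ^ m)
    {G : Type*} [Group G] (hcard : Nat.card G = p ^ m)
    (hnonab : ¬ ∀ a b : G, a * b = b * a)
    (huniq : ∀ k ∈ Finset.Icc 2 (p + 1), ∃! N : Subgroup G, N.Normal ∧ N.index = p ^ k) :
    IsOfMaximalClass p G := by
  have : Fact p.Prime := ⟨hp⟩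
  have hpm : p < m := (Nat.pow_lt_pow_iff_right hp.one_lt).1 hm
  have hp2 := hp.two_le
  have : Finite G := Nat.finite_of_card_ne_zero (hcard ▸ (pow_pos hp.pos m).ne')
  have hnil : Group.IsNilpotent G := (IsPGroup.of_card hcard).isNilpotent
  obtain ⟨hi2, h2, a, b, hab⟩ := gam_two_of_existsUnique hp hcard hnonab
    (huniq 2 (Finset.mem_Icc.2 ⟨le_rfl, by omega⟩))
  have hbot : ∀ {i}, (gam G i).index = p ^ i → gam G i = ⊥ → i = m := by
    intro i h1 h3
    rw [h3, Subgroup.index_bot, hcard] at h1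
    exact (Nat.pow_right_injective hp.two_le h1).symm
  have hfirst : ∀ i, 2 ≤ i → i ≤ p → (gam G i).index = p ^ i ∧ ∃ e : G, IsLayerGen i e := by
    intro i hi hip
    have hgen : (gam G i).index = p ^ i → ∃ e : G, IsLayerGen i e := fun h =>
      exists_isLayerGen_of_existsUnique hp hcard (by omega) h
        (huniq (i + 1) (Finset.mem_Icc.2 ⟨by omega, by omega⟩))
    -- Since p < m, an index p^i with i ≤ p keeps `gam G i` nontrivial, so each cyclic layer has
    -- order exactly p.
    have hidx : (gam G i).index = p ^ i := by
      clear hgen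
      induction i, hi using Nat.le_induction with
      | base => exact hi2
      | succ i hi ih =>
        have h := ih (by omega)
        obtain ⟨e, he⟩ := exists_isLayerGen_of_existsUnique hp hcard (by omega) h
          (huniq (i + 1) (Finset.mem_Icc.2 ⟨by omega, by omega⟩))
        exact he.index_succ hp h2 (by omega) (fun h3 => by have := hbot h h3; omega) h
    exact ⟨hidx, hgen hidx⟩
  have hlayer : ∀ {i}, 2 ≤ i → ∃ e : G, IsLayerGen i e := fun hi =>
    exists_isLayerGen hp h2 hab (fun j hj hjp => (hfirst j hj hjp).2) hi
  have hclass : ∀ {i}, gam G (i + 1) = ⊥ ↔ Group.nilpotencyClass G ≤ i :=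
    Subgroup.lowerCentralSeries_eq_bot_iff_nilpotencyClass_le
  have hc : 1 < Group.nilpotencyClass G := by
    by_contra h
    have := hbot hi2 (hclass.2 (not_lt.1 h))
    omega
  have hall : ∀ i, 2 ≤ i → i ≤ Group.nilpotencyClass G + 1 → (gam G i).index = p ^ i := by
    intro i hi
    induction i, hi using Nat.le_induction with
    | base => exact fun _ => hi2
    | succ i hi ih =>
      intro hic
      obtain ⟨e, he⟩ := hlayer hi
      refine he.index_succ hp h2 (by omega) (fun h3 => ?_) (ih (by omega))
      obtain ⟨j, rfl⟩ := Nat.exists_eq_add_of_le' (show 1 ≤ i by omega)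
      have := hclass.1 h3
      omega
  -- The term after the last nontrivial one is trivial and has index p^(class + 1), which must equal
  -- |G|.
  exact ⟨hp, m, hcard, hnil, hbot (hall _ (by omega) le_rfl) (hclass.2 le_rfl), hc⟩
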